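/- Let $m\ge 2$ and let $T_m$ be the rooted $m$-adic tree, whose vertices are the finite words on $\{1,\dots,m\}$, with the empty word as root and each $v$ joined to the words $vx$, $x\in\{1,\dots,m\}$. Let $\mathrm{Aut}\,T_m$ be the group of graph automorphisms of $T_m$ fixing the root. For $g\in\mathrm{Aut}\,T_m$ and a vertex $v$, the label of $g$ at $v$ is the permutation $g|_v^1\in\mathrm{Sym}(m)$ such that $g$ sends $vx$ to the word obtained by appending the image of $x$ under $g|_v^1$ to the image of $v$ under $g$. For $H\le \mathrm{Sym}(m)$ let $$W_H=\{g\in\mathrm{Aut}\,T_m \mid g|_v^1\in H\text{ for every vertex } v\}$$ be the iterated permutational wreath product. Let $\mathrm{St}_{W_H}(n)$ be the subgroup of elements of $W_H$ fixing every word of length $n$, and let $\mathcal S=\{\mathrm{St}_{W_H}(n)\}_{n\ge 0}$ be the level-stabilizer filtration. Equip $W_H$ with the topology in which $\mathcal S$ is a neighbourhood basis of the identity, which is also the topology of the metric $d(x,y)=\inf\{|W_H:\mathrm{St}_{W_H}(n)|^{-1} \mid xy^{-1}\in \mathrm{St}_{W_H}(n)\}$ when $H\neq 1$. Let $\mathrm{hdim}^{\mathcal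 S}$ denote Hausdorff dimension with respect to $d$, and let $\mathrm{hspec}^{\mathcal S}(W_H)$, $\mathrm{hspec}^{\mathcal S}_{\mathrm{fg}}(W_H)$ and $\mathrm{hspec}^{\mathcal S}_{b}(W_H)$ be the sets of Hausdorff dimensions of, respectively, all closed subgroups of $W_H$, those that are topologically finitely generated, and those that are topologically generated by at most $b$ elements. **Theorem.** Let $m\ge 2$ and let $H\le\mathrm{Sym}(m)$ be transitive. Then there exists an integer $b\ge 2$ such that $$\mathrm{hspec}^{\mathcal S}_{b}(W_H)=\mathrm{hspec}^{\mathcal S}_{\mathrm{fg}}(W_H)=\mathrm{hspec}^{\mathcal S}(W_H)=[0,1].$$ -/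

import Mathlib

open scoped ENNReal

/-! ### Filtrations of groups, the metric and the topology they induce -/

/-- A filtration series of a group `G`: a descending chain `G = G₀ ⊇ G₁ ⊇ …` of normal subgroups of
finite index with trivial intersection. -/
structure GroupFiltration (G : Type*) [Group G] where
  /-- The terms of the filtration. -/
  term : ℕ → Subgroup G
  term_zero : term 0 = ⊤
  antitone : Antitone term
  normal : ∀ i, (term i).Normal
  finiteIndex : ∀ i, (term i).FiniteIndex
  iInf_eq_bot : ⨅ i, term i = ⊥

namespace GroupFiltration

variable {G : Type*} [Group G] (F : GroupFiltration G)

/-- The distance `inf {|G : Gᵢ|⁻¹ | x y⁻¹ ∈ Gᵢ}`. For infinite `G` this infimum is `0` when `x = y`;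
the case distinction only makes it a distance on finite groups too. -/
noncomputable def distance (x y : G) : ℝ≥0∞ :=
  open Classical in
  if x = y then 0 else ⨅ (i : ℕ) (_ : x * y⁻¹ ∈ F.term i), ((F.term i).index : ℝ≥0∞)⁻¹

/-- The metric on `G` induced by the filtration. -/
@[reducible]
noncomputable def metric : EMetricSpace G where
  edist := F.distance
  edist_self x := by simp [distance]
  edist_comm x y := by
    have h : ∀ i, x * y⁻¹ ∈ F.term i ↔ y * x⁻¹ ∈ F.term i := fun i => by
      rw [← inv_mem_iff]; simp
    by_cases hxy : x = y
    · subst hxy; rfl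
    · simp only [distance, h, hxy, Ne.symm hxy, if_false]
  edist_triangle x y z := by
    simp only [distance]
    by_cases hxz : x = z
    · simp [hxz]
    by_cases hxy : x = y
    · subst hxy; simp
    by_cases hyz : y = z
    · subst hyz; simp
    simp only [hxz, hxy, hyz, if_false]
    simp only [ENNReal.iInf_add, ENNReal.add_iInf]
    refine le_iInf fun j => le_iInf fun hj => le_iInf fun i => le_iInf fun hi => ?_
    have hij : x * z⁻¹ ∈ F.term (min i j) := by
      have h1 := F.antitone (min_le_left i j) hi
      have h2 := F.antitone (min_le_right i j) hj
      simpa [mul_assoc] using mul_mem h1 h2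
    refine (iInf₂_le (min i j) hij).trans ?_
    rcases min_choice i j with h | h <;> rw [h]
    · exact le_self_add
    · exact le_add_self
  eq_of_edist_eq_zero := by
    intro x y h
    by_contra hxy
    change F.distance x y = 0 at h
    simp only [distance, hxy, if_false] at h
    have hne : x * y⁻¹ ∉ ⨅ i, F.term i := by
      rw [F.iInf_eq_bot, Subgroup.mem_bot, mul_inv_eq_one]; exact hxy
    obtain ⟨n, hn⟩ : ∃ n, x * y⁻¹ ∉ F.term n := by
      simpa [Subgroup.mem_iInf] using hne
    have hle : ((F.term n).index : ℝ≥0∞)⁻¹ ≤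
        ⨅ (i : ℕ) (_ : x * y⁻¹ ∈ F.term i), ((F.term i).index : ℝ≥0∞)⁻¹ := by
      refine le_iInf₂ fun i hi => ?_
      have hin : i ≤ n := by
        by_contra hlt
        exact hn (F.antitone (le_of_lt (not_le.mp hlt)) hi)
      have := F.finiteIndex n
      have := Subgroup.index_antitone (F.antitone hin)
      rw [ENNReal.inv_le_inv]
      exact_mod_cast this
    rw [h, nonpos_iff_eq_zero, ENNReal.inv_eq_zero] at hle
    exact ENNReal.natCast_ne_top _ hle

/-- The topology on `G` in which the terms of the filtration form a neighbourhood basis of `1`. -/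
@[reducible]
def topology : TopologicalSpace G where
  IsOpen U := ∀ g ∈ U, ∃ n, ∀ k ∈ F.term n, g * k ∈ U
  isOpen_univ _ _ := ⟨0, fun _ _ => Set.mem_univ _⟩
  isOpen_inter U V hU hV g hg := by
    obtain ⟨a, ha⟩ := hU g hg.1
    obtain ⟨b, hb⟩ := hV g hg.2
    exact ⟨max a b, fun k hk => ⟨ha k (F.antitone (le_max_left a b) hk),
      hb k (F.antitone (le_max_right a b) hk)⟩⟩
  isOpen_sUnion S hS g hg := by
    obtain ⟨U, hU, hgU⟩ := hg
    obtain ⟨n, hn⟩ := hS U hU g hgU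
    exact ⟨n, fun k hk => ⟨U, hU, hn k hk⟩⟩

/-- `K` is a closed subgroup of `G`. -/
def IsClosedSubgroup (K : Subgroup G) : Prop :=
  @IsClosed G F.topology (K : Set G)

/-- `K` is the topological closure of the abstract subgroup generated by `S`. -/
def TopologicallyGenerates (S : Set G) (K : Subgroup G) : Prop :=
  (K : Set G) = @closure G F.topology (Subgroup.closure S : Set G)

/-- The Hausdorff dimension of `K` with respect to the metric induced by the filtration. -/
noncomputable def hdim (K : Subgroup G) : ℝ≥0∞ :=
  @dimH G F.metric (K : Set G)

/-- The Hausdorff spectrum: the Hausdorff dimensions of the closed subgroups. -/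
def hspec : Set ℝ≥0∞ :=
  {d | ∃ K : Subgroup G, F.IsClosedSubgroup K ∧ F.hdim K = d}

/-- The finitely generated Hausdorff spectrum: the Hausdorff dimensions of the topologically finitely
generated closed subgroups. -/
def hspecFG : Set ℝ≥0∞ :=
  {d | ∃ K : Subgroup G, F.IsClosedSubgroup K ∧
    (∃ S : Finset G, F.TopologicallyGenerates (S : Set G) K) ∧ F.hdim K = d}

/-- The `b`-bounded Hausdorff spectrum: the Hausdorff dimensions of the closed subgroups that are
topologically generated by at most `b` elements. -/
def hspecBounded (b : ℕ) : Set ℝ≥0∞ :=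
  {d | ∃ K : Subgroup G, F.IsClosedSubgroup K ∧
    (∃ S : Finset G, S.card ≤ b ∧ F.TopologicallyGenerates (S : Set G) K) ∧ F.hdim K = d}

end GroupFiltration

/-! ### The `m`-adic tree and its automorphisms

Vertices are the finite words on `Fin m`; the root is the empty word and the children of `v` are the
words `v ++ [x]`. -/

/-- The `m`-adic tree as a graph. -/
def adicTree (m : ℕ) : SimpleGraph (List (Fin m)) where
  Adj u v := ∃ x, u = v ++ [x] ∨ v = u ++ [x]
  symm := ⟨fun _ _ ⟨x, h⟩ => ⟨x, h.symm⟩⟩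
  loopless := ⟨fun u ⟨x, h⟩ => by rcases h with h | h <;> simp at h⟩

/-- The automorphism group of the rooted `m`-adic tree: bijections of the vertex set preserving
adjacency and fixing the root. -/
def TreeAut (m : ℕ) : Subgroup (Equiv.Perm (List (Fin m))) where
  carrier := {g | g [] = [] ∧ ∀ u v, (adicTree m).Adj (g u) (g v) ↔ (adicTree m).Adj u v}
  one_mem' := by simp
  mul_mem' := by
    rintro g h ⟨hg, hg'⟩ ⟨hh, hh'⟩
    exact ⟨by simp [hh, hg], fun u v => by simp [hg', hh']⟩
  inv_mem' := by
    rintro g ⟨hg, hg'⟩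
    refine ⟨by rw [Equiv.Perm.inv_eq_iff_eq, hg], fun u v => ?_⟩
    rw [← hg']; simp

namespace TreeAut

variable {m : ℕ}

theorem adj_iff (g : TreeAut m) (u v : List (Fin m)) :
    (adicTree m).Adj (g.1 u) (g.1 v) ↔ (adicTree m).Adj u v := g.2.2 u v

/-- Automorphisms preserve levels and send the parent of a vertex to the parent of its image. -/
theorem exists_child (g : TreeAut m) (v : List (Fin m)) :
    (g.1 v).length = v.length ∧ ∀ x, ∃ y, g.1 (v ++ [x]) = g.1 v ++ [y] := by
  induction v using List.reverseRecOn with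
  | nil =>
    refine ⟨by rw [g.2.1], fun x => ?_⟩
    obtain ⟨y, h | h⟩ := (adj_iff g ([] ++ [x]) []).2 ⟨x, Or.inl rfl⟩
    · exact ⟨y, h⟩
    · rw [g.2.1] at h; simp at h
  | append_singleton u z ih =>
    obtain ⟨w, hw⟩ := ih.2 z
    refine ⟨by rw [hw]; simp [ih.1], fun x => ?_⟩
    obtain ⟨y, h | h⟩ := (adj_iff g (u ++ [z] ++ [x]) (u ++ [z])).2 ⟨x, Or.inl rfl⟩
    · exact ⟨y, h⟩
    · exfalso
      rw [hw] at h
      have h1 := (List.append_inj' h rfl).1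
      have h2 := congrArg List.length (g.1.injective h1)
      simp at h2

theorem length_apply (g : TreeAut m) (v : List (Fin m)) : (g.1 v).length = v.length :=
  (exists_child g v).1

/-- The level stabilizer `St(n)`: the automorphisms fixing all vertices of level `n`. -/
def levelStabilizer (m n : ℕ) : Subgroup (TreeAut m) where
  carrier := {g | ∀ v : List (Fin m), v.length = n → g.1 v = v}
  one_mem' := by simp
  mul_mem' := by
    intro g h hg hh v hv
    simp [hh v hv, hg v hv]
  inv_mem' := by
    intro g hg v hv
    change (g.1)⁻¹ v = v
    rw [Equiv.Perm.inv_eq_iff_eq, hg v hv]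

theorem mem_levelStabilizer {n : ℕ} {g : TreeAut m} :
    g ∈ levelStabilizer m n ↔ ∀ v : List (Fin m), v.length = n → g.1 v = v := Iff.rfl

theorem levelStabilizer_zero : levelStabilizer m 0 = ⊤ := by
  refine eq_top_iff.2 fun g _ v hv => ?_
  rw [List.length_eq_zero_iff.1 hv, g.2.1]

theorem levelStabilizer_antitone : Antitone (levelStabilizer m) := by
  refine antitone_nat_of_succ_le fun n g hg v hv => ?_
  rcases m with _ | m
  · have : v = [] := by
      cases v with
      | nil => rfl
      | cons a _ => exact a.elim0
    rw [this, g.2.1]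
  · obtain ⟨y, hy⟩ := (exists_child g v).2 0
    rw [hg (v ++ [0]) (by simp [hv])] at hy
    exact (List.append_inj' hy rfl).1.symm

theorem levelStabilizer_normal (n : ℕ) : (levelStabilizer m n).Normal := by
  refine ⟨fun g hg h v hv => ?_⟩
  change h.1 (g.1 ((h⁻¹).1 v)) = v
  rw [hg _ (by rw [length_apply, hv])]
  change h.1 ((h.1)⁻¹ v) = v
  simp

theorem iInf_levelStabilizer : ⨅ n, levelStabilizer m n = ⊥ := by
  refine (Subgroup.eq_bot_iff_forall _).2 fun g hg => ?_
  rw [Subgroup.mem_iInf] at hg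
  exact Subtype.ext (Equiv.ext fun v => hg v.length v rfl)

theorem levelStabilizer_finiteIndex (n : ℕ) : (levelStabilizer m n).FiniteIndex := by
  let f : TreeAut m → (List.Vector (Fin m) n → List.Vector (Fin m) n) :=
    fun g v => ⟨g.1 v.1, by rw [length_apply, v.2]⟩
  have key : ∀ g h : TreeAut m, f g = f h → g⁻¹ * h ∈ levelStabilizer m n := by
    intro g h hgh v hv
    have h1 : g.1 v = h.1 v := congrArg Subtype.val (congrFun hgh ⟨v, hv⟩)
    change (g.1)⁻¹ (h.1 v) = v
    rw [← h1]; simp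
  have : Finite (TreeAut m ⧸ levelStabilizer m n) := by
    refine Finite.of_injective (fun q => f q.out) fun a b hab => ?_
    rw [← Quotient.out_eq' a, ← Quotient.out_eq' b]
    exact QuotientGroup.eq.2 (key _ _ hab)
  exact Subgroup.finiteIndex_of_finite_quotient

/-- The level-stabilizer filtration of a group `G` of tree automorphisms, with terms
`St_G(n) = St(n) ∩ G`. -/
def levelFiltration (G : Subgroup (TreeAut m)) : GroupFiltration G where
  term n := (levelStabilizer m n).subgroupOf G
  term_zero := by rw [levelStabilizer_zero, Subgroup.top_subgroupOf]
  antitone _ _ h := Subgroup.comap_mono (levelStabilizer_antitone h)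
  normal n := by
    have := levelStabilizer_normal (m := m) n
    infer_instance
  finiteIndex n := by
    have := levelStabilizer_finiteIndex (m := m) n
    infer_instance
  iInf_eq_bot := by
    refine (Subgroup.eq_bot_iff_forall _).2 fun g hg => ?_
    have h : (g : TreeAut m) ∈ ⨅ n, levelStabilizer m n := by
      simp only [Subgroup.mem_iInf, Subgroup.mem_subgroupOf] at hg ⊢
      exact hg
    rw [iInf_levelStabilizer, Subgroup.mem_bot] at h
    exact Subtype.ext h

end TreeAut

/-- The iterated permutational wreath product `W_H`: the automorphisms all of whose labels lie in `H`.
The label of `g` at `v` is the unique permutation `σ` of `Fin m` with `g (v x) = g(v) σ(x)`. -/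
def iteratedWreathProduct {m : ℕ} (H : Subgroup (Equiv.Perm (Fin m))) : Subgroup (TreeAut m) where
  carrier := {g | ∀ v : List (Fin m), ∃ σ ∈ H, ∀ x, g.1 (v ++ [x]) = g.1 v ++ [σ x]}
  one_mem' v := ⟨1, H.one_mem, by simp⟩
  mul_mem' := by
    intro g h hg hh v
    obtain ⟨τ, hτ, hτ'⟩ := hh v
    obtain ⟨σ, hσ, hσ'⟩ := hg (h.1 v)
    exact ⟨σ * τ, H.mul_mem hσ hτ, fun x => by simp [hτ', hσ']⟩
  inv_mem' := by
    intro g hg v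
    obtain ⟨σ, hσ, hσ'⟩ := hg ((g.1)⁻¹ v)
    refine ⟨σ⁻¹, H.inv_mem hσ, fun x => ?_⟩
    change (g.1)⁻¹ (v ++ [x]) = (g.1)⁻¹ v ++ [σ⁻¹ x]
    rw [Equiv.Perm.inv_eq_iff_eq, hσ']
    simp

/-! Relative indices divide indices, so no dimension exceeds 1. The task is to realize every a in
[0,1] by a closed subgroup whose number of generators depends only on H.

`exists_region` supplies a set U of vertices, closed under passing to children, whose number of
vertices on level n is a * m ^ n up to an error of 1. Let A be its set of minimal vertices, which
may be infinite. All generators act below A, hence the labels of the closed group K they generate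
are trivial off U. Since |W_H : St(n)| is |H| to the number of words shorter than n, `relIndex_le`
and the covering by cosets in `hdim_le` give dimension at most a. For the reverse bound,
`le_relIndex` and the mass distribution principle `le_hdim` reduce the claim to this: for each b <
a, on every sufficiently large level N, K realizes all labels independently on at least b * m ^ N
vertices.

Finitely many generators achieve this by acting at infinitely many sparse places. Odometers along
the ray z z z …, copied below every vertex of A, act transitively on each level below such a vertex.
A power of the odometer of σ acts on words z … z like addition in base r, the period of z under σ.
Each pair (v, n) with v in A and n large gets a position below v, given by an exponent with two
nonzero base-r digits. One generator is the rooted σ at all positions. Others are rooted elements of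
H at vertices deeper below the positions, translated by an odometer power depending on (v, n).
Conjugation by the power attached to one pair undoes the translation for that pair only
(`code_separated`), so the commutator of the two generators lives below a single position. On the
relevant level it has an arbitrary label at one vertex and a further nontrivial label at one other
vertex at most (`isolates_position`).

Conjugation by odometers, with separate ones placed at the children z of the positions, moves the
first vertex to any v c y with c of length about half of N, while its partner depends only on v and
c (`exists_isolates`). For the finitely many v of length at most k there are thus at most C * m ^ (N
/ 2) partners. Discarding them leaves almost all of the vertices with a prefix in U of length k, and
their density is nearly a when k is large (`exists_isolated_level`, `exists_isolated_set`). -/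

/-! ### Labels and portraits of elements of the iterated wreath product -/

namespace IteratedWreath

variable {m : ℕ} {H : Subgroup (Equiv.Perm (Fin m))}

/-- The label of `g` at the vertex `v`. -/
noncomputable def label (g : iteratedWreathProduct H) (v : List (Fin m)) : H :=
  ⟨Classical.choose (g.2 v), (Classical.choose_spec (g.2 v)).1⟩

theorem smul_concat (g : iteratedWreathProduct H) (v : List (Fin m)) (x : Fin m) :
    g • (v ++ [x]) = g • v ++ [(label g v).1 x] :=
  (Classical.choose_spec (g.2 v)).2 x

theorem length_smul (g : iteratedWreathProduct H) (v : List (Fin m)) :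
    (g • v).length = v.length :=
  TreeAut.length_apply g.1 v

theorem smul_nil (g : iteratedWreathProduct H) : g • ([] : List (Fin m)) = [] :=
  List.length_eq_zero_iff.1 (length_smul g [])

theorem label_eq_of_forall {g : iteratedWreathProduct H} {v : List (Fin m)} {σ : H}
    (h : ∀ x, g • (v ++ [x]) = g • v ++ [σ.1 x]) : label g v = σ := by
  refine Subtype.ext (Equiv.ext fun x => ?_)
  have := (smul_concat g v x).symm.trans (h x)
  simpa using this

theorem label_mul (g k : iteratedWreathProduct H) (v : List (Fin m)) :
    label (g * k) v = label g (k • v) * label k v :=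
  label_eq_of_forall fun x => by simp [mul_smul, smul_concat]

theorem label_one (v : List (Fin m)) : label (1 : iteratedWreathProduct H) v = 1 :=
  label_eq_of_forall fun x => by simp

theorem take_smul (g : iteratedWreathProduct H) (v : List (Fin m)) (n : ℕ) :
    (g • v).take n = g • v.take n := by
  induction v using List.reverseRecOn with
  | nil => simp [smul_nil]
  | append_singleton v x ih =>
    rcases le_or_gt n v.length with h | h
    · rw [smul_concat, List.take_append_of_le_length (by rwa [length_smul]),
        List.take_append_of_le_length h, ih]
    · rw [List.take_of_length_le (l := v ++ [x]) (by simpa using h),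
        List.take_of_length_le (by rw [length_smul]; simpa using h)]

theorem smul_prefix_smul_iff (g : iteratedWreathProduct H) {u v : List (Fin m)} :
    g • u <+: g • v ↔ u <+: v := by
  rw [List.prefix_iff_eq_take, List.prefix_iff_eq_take, length_smul, take_smul,
    smul_left_cancel_iff]

theorem smul_append_eq (g : iteratedWreathProduct H) (u v : List (Fin m)) :
    ∃ v', v'.length = v.length ∧ g • (u ++ v) = g • u ++ v' := by
  obtain ⟨t, ht⟩ := (smul_prefix_smul_iff g).2 (List.prefix_append u v)
  refine ⟨t, ?_, ht.symm⟩
  have := congrArg List.length ht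
  simp only [List.length_append, length_smul] at this
  omega

theorem ext_of_label {g k : iteratedWreathProduct H} {n : ℕ}
    (h : ∀ v : List (Fin m), v.length < n → label g v = label k v) (v : List (Fin m))
    (hv : v.length ≤ n) : g • v = k • v := by
  induction v using List.reverseRecOn with
  | nil => simp [smul_nil]
  | append_singleton v x ih =>
    simp only [List.length_append, List.length_singleton] at hv
    rw [smul_concat, smul_concat, ih (by omega), h v (by omega)]

theorem mem_term {n : ℕ} {g : iteratedWreathProduct H} :
    g ∈ (TreeAut.levelFiltration (iteratedWreathProduct H)).term n ↔
      ∀ v : List (Fin m), v.length = n → g • v = v := Iff.rfl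

theorem smul_eq_of_mem_term {n : ℕ} {g : iteratedWreathProduct H}
    (hg : g ∈ (TreeAut.levelFiltration (iteratedWreathProduct H)).term n) {v : List (Fin m)}
    (hv : v.length ≤ n) : g • v = v :=
  mem_term.1 ((TreeAut.levelFiltration (iteratedWreathProduct H)).antitone hv hg) v rfl

theorem label_eq_one_of_mem_term {n : ℕ} {g : iteratedWreathProduct H}
    (hg : g ∈ (TreeAut.levelFiltration (iteratedWreathProduct H)).term n) {v : List (Fin m)}
    (hv : v.length < n) : label g v = 1 :=
  label_eq_of_forall fun x => by
    rw [smul_eq_of_mem_term hg hv.le, smul_eq_of_mem_term hg (by simpa using hv)]; simp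

theorem inv_mul_mem_term_iff {n : ℕ} {g k : iteratedWreathProduct H} :
    g⁻¹ * k ∈ (TreeAut.levelFiltration (iteratedWreathProduct H)).term n ↔
      ∀ v : List (Fin m), v.length < n → label g v = label k v := by
  constructor
  · intro h v hv
    have h1 : k = g * (g⁻¹ * k) := by group
    rw [h1, label_mul, smul_eq_of_mem_term h hv.le, label_eq_one_of_mem_term h hv, mul_one]
  · intro h v hv
    change (g⁻¹ * k) • v = v
    rw [mul_smul, ← ext_of_label h v hv.le, inv_smul_smul]

/-- A map of words with labels in `H` is an element of the iterated wreath product. -/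
theorem exists_of_labels (f : List (Fin m) → List (Fin m)) (h0 : f [] = [])
    (hf : ∀ v, ∃ σ ∈ H, ∀ x, f (v ++ [x]) = f v ++ [σ x]) :
    ∃ g : iteratedWreathProduct H, ∀ v : List (Fin m), g • v = f v := by
  have hlen : ∀ v, (f v).length = v.length := by
    intro v
    induction v using List.reverseRecOn with
    | nil => simp [h0]
    | append_singleton v x ih => obtain ⟨σ, -, h⟩ := hf v; simp [h, ih]
  have hinj : ∀ v w, f v = f w → v = w := by
    intro v
    induction v using List.reverseRecOn with
    | nil =>
      intro w hw
      have := hlen w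
      rw [← hw, h0] at this
      exact (List.length_eq_zero_iff.1 this.symm).symm
    | append_singleton v x ih =>
      intro w hw
      rcases List.eq_nil_or_concat w with rfl | ⟨w, y, rfl⟩
      · have := congrArg List.length hw
        simp [hlen] at this
      · rw [List.concat_eq_append] at hw ⊢
        obtain ⟨σ, -, h⟩ := hf v
        obtain rfl : v = w := by
          obtain ⟨τ, -, h'⟩ := hf w
          rw [h, h'] at hw
          exact ih _ (List.append_inj' hw rfl).1
        rw [h, h] at hw
        simpa using hw
  have hsurj : ∀ w, ∃ v, f v = w := by
    intro w
    induction w using List.reverseRecOn with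
    | nil => exact ⟨[], h0⟩
    | append_singleton w x ih =>
      obtain ⟨v, rfl⟩ := ih
      obtain ⟨σ, -, h⟩ := hf v
      exact ⟨v ++ [σ⁻¹ x], by simp [h]⟩
  let e : Equiv.Perm (List (Fin m)) := Equiv.ofBijective f ⟨fun v w => hinj v w, hsurj⟩
  have key : ∀ u v, (∃ x, f u = f v ++ [x]) ↔ ∃ x, u = v ++ [x] := by
    intro u v
    obtain ⟨σ, -, h⟩ := hf v
    constructor
    · rintro ⟨x, hx⟩
      exact ⟨σ⁻¹ x, hinj _ _ (by rw [hx, h]; simp)⟩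
    · rintro ⟨x, rfl⟩
      exact ⟨σ x, h x⟩
  refine ⟨⟨⟨e, h0, fun u v => ?_⟩, hf⟩, fun v => rfl⟩
  change (∃ x, f u = f v ++ [x] ∨ f v = f u ++ [x]) ↔ ∃ x, u = v ++ [x] ∨ v = u ++ [x]
  rw [exists_or, exists_or, key, key]

/-- The action on words prescribed by a family of labels. -/
def portraitAct (l : List (Fin m) → H) : List (Fin m) → List (Fin m)
  | [] => []
  | x :: w => (l []).1 x :: portraitAct (fun u => l (x :: u)) w

theorem portraitAct_concat (l : List (Fin m) → H) (v : List (Fin m)) (x : Fin m) :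
    portraitAct l (v ++ [x]) = portraitAct l v ++ [(l v).1 x] := by
  induction v generalizing l with
  | nil => rfl
  | cons y v ih => simp [portraitAct, ih]

/-- The element of the iterated wreath product with given labels. -/
noncomputable def ofPortrait (l : List (Fin m) → H) : iteratedWreathProduct H :=
  (exists_of_labels (portraitAct l) rfl
    fun v => ⟨(l v).1, (l v).2, portraitAct_concat l v⟩).choose

theorem ofPortrait_smul (l : List (Fin m) → H) (v : List (Fin m)) :
    ofPortrait l • v = portraitAct l v :=
  (exists_of_labels (portraitAct l) rfl
    fun v => ⟨(l v).1, (l v).2, portraitAct_concat l v⟩).choose_spec v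

@[simp]
theorem label_ofPortrait (l : List (Fin m) → H) (v : List (Fin m)) :
    label (ofPortrait l) v = l v :=
  label_eq_of_forall fun x => by rw [ofPortrait_smul, ofPortrait_smul, portraitAct_concat]

theorem ext_label {g k : iteratedWreathProduct H}
    (h : ∀ v : List (Fin m), label g v = label k v) : g = k := by
  refine Subtype.ext (Subtype.ext (Equiv.ext fun v => ?_))
  exact ext_of_label (fun v _ => h v) v le_rfl

/-! ### Counting cosets of level stabilizers -/

theorem index_eq_card_range {G β : Type*} [Group G] (N : Subgroup G) (φ : G → β)
    (h : ∀ a b, φ a = φ b ↔ a⁻¹ * b ∈ N) : N.index = Nat.card (Set.range φ) := by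
  refine Nat.card_congr (Equiv.ofBijective
    (Quotient.lift (s := QuotientGroup.leftRel N) (fun a => (⟨φ a, a, rfl⟩ : Set.range φ))
      fun a b hab => Subtype.ext ((h a b).2 (QuotientGroup.leftRel_apply.1 hab))) ⟨?_, ?_⟩)
  · rintro ⟨a⟩ ⟨b⟩ hab
    exact Quotient.sound (QuotientGroup.leftRel_apply.2
      ((h a b).1 (congrArg Subtype.val hab)))
  · rintro ⟨_, a, rfl⟩
    exact ⟨Quotient.mk _ a, rfl⟩

/-- The words of length less than `n` in a set `U`. -/
def below (U : Set (List (Fin m))) (n : ℕ) : Set (List (Fin m)) := {w | w.length < n ∧ w ∈ U}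

theorem finite_below (U : Set (List (Fin m))) (n : ℕ) : (below U n).Finite :=
  (List.finite_length_lt (Fin m) n).subset fun _ h => h.1

theorem card_below_fun (U : Set (List (Fin m))) (n : ℕ) :
    Nat.card (below U n → H) = Nat.card H ^ (below U n).ncard := by
  have := (finite_below U n).to_subtype
  rw [Nat.card_fun]; rfl

/-- Modulo St(n) an element is determined by its labels at words shorter than n, and for elements of
K only those in U can vary. -/
theorem relIndex_le (K : Subgroup (iteratedWreathProduct H)) (U : Set (List (Fin m)))
    (hK : ∀ g ∈ K, ∀ w ∉ U, label g w = 1) (n : ℕ) :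
    ((TreeAut.levelFiltration (iteratedWreathProduct H)).term n).relIndex K ≤
      Nat.card H ^ (below U n).ncard := by
  have := (finite_below U n).to_subtype
  rw [Subgroup.relIndex, index_eq_card_range _
    (fun (g : K) (w : below U n) => label g.1 w.1), ← card_below_fun]
  · exact Nat.card_le_card_of_injective _ Subtype.val_injective
  · intro a b
    rw [Subgroup.mem_subgroupOf, Subgroup.coe_mul, Subgroup.coe_inv, inv_mul_mem_term_iff,
      funext_iff]
    constructor
    · intro h v hv
      by_cases hU : v ∈ U
      · exact h ⟨v, hv, hU⟩
      · rw [hK _ a.2 _ hU, hK _ b.2 _ hU]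
    · intro h w
      exact h _ w.2.1

/-- Labels are corrected level by level. Right multiplication by an element of St(n) leaves the
labels above level n unchanged, and on level n the labels simply multiply, so the vertices of U on
that level can be treated one at a time. -/
theorem exists_label_eq (K : Subgroup (iteratedWreathProduct H)) (U : Set (List (Fin m)))
    (hK : ∀ u ∈ U, ∀ h : H, ∃ s ∈ K,
      s ∈ (TreeAut.levelFiltration (iteratedWreathProduct H)).term u.length ∧ label s u = h ∧
        ∀ w ∈ U, w.length = u.length → w ≠ u → label s w = 1)
    (f : List (Fin m) → H) (n : ℕ) : ∃ g ∈ K, ∀ w ∈ U, w.length < n → label g w = f w := by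
  classical
  induction n with
  | zero => exact ⟨1, K.one_mem, fun w _ h => by simp at h⟩
  | succ n ih =>
    obtain ⟨g, hg, hgf⟩ := ih
    have key : ∀ T : Finset (List (Fin m)), (∀ u ∈ T, u ∈ U ∧ u.length = n) →
        ∃ s ∈ K, s ∈ (TreeAut.levelFiltration (iteratedWreathProduct H)).term n ∧
          ∀ w ∈ U, w.length = n →
            label s w = if w ∈ T then (label g w)⁻¹ * f w else 1 := by
      intro T
      induction T using Finset.induction with
      | empty => exact fun _ => ⟨1, K.one_mem, Subgroup.one_mem _, by simp [label_one]⟩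
      | insert u T hu ih =>
        intro hT
        obtain ⟨s, hsK, hs, hsl⟩ := ih fun w hw => hT w (Finset.mem_insert_of_mem hw)
        obtain ⟨huU, hun⟩ := hT u (Finset.mem_insert_self _ _)
        obtain ⟨s', hsK', hs', hl, hl'⟩ := hK u huU ((label g u)⁻¹ * f u)
        rw [hun] at hs' hl'
        refine ⟨s * s', K.mul_mem hsK hsK', Subgroup.mul_mem _ hs hs', fun w hw hwn => ?_⟩
        rw [label_mul, smul_eq_of_mem_term hs' hwn.le, hsl w hw hwn]
        by_cases hwu : w = u
        · subst hwu; simp [hu, hl]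
        · simp [hwu, hl' w hw hwn hwu]
    obtain ⟨s, hsK, hs, hsl⟩ := key
      (((List.finite_length_eq (Fin m) n).toFinset).filter (· ∈ U))
      (by simpa using fun u h hu => ⟨hu, h⟩)
    refine ⟨g * s, K.mul_mem hg hsK, fun w hw hwn => ?_⟩
    rcases Nat.lt_succ_iff_lt_or_eq.1 hwn with h | h
    · rw [label_mul, smul_eq_of_mem_term hs h.le, label_eq_one_of_mem_term hs h, mul_one,
        hgf w hw h]
    · rw [label_mul, smul_eq_of_mem_term hs h.le, hsl w hw h]
      simp [h, hw]

theorem le_relIndex (K : Subgroup (iteratedWreathProduct H)) (U : Set (List (Fin m)))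
    (hK : ∀ u ∈ U, ∀ h : H, ∃ s ∈ K,
      s ∈ (TreeAut.levelFiltration (iteratedWreathProduct H)).term u.length ∧ label s u = h ∧
        ∀ w ∈ U, w.length = u.length → w ≠ u → label s w = 1) (n : ℕ) :
    Nat.card H ^ (below U n).ncard ≤
      ((TreeAut.levelFiltration (iteratedWreathProduct H)).term n).relIndex K := by
  have := (finite_below U n).to_subtype
  have hfin : (((TreeAut.levelFiltration (iteratedWreathProduct H)).term n).subgroupOf
      K).FiniteIndex := by
    have := (TreeAut.levelFiltration (iteratedWreathProduct H)).finiteIndex n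
    infer_instance
  rw [Subgroup.relIndex, Subgroup.index, ← card_below_fun]
  have := Subgroup.finite_quotient_of_finiteIndex
    (H := ((TreeAut.levelFiltration (iteratedWreathProduct H)).term n).subgroupOf K)
  refine Nat.card_le_card_of_surjective
    (Quotient.lift (fun (g : K) (w : below U n) => label g.1 w.1) fun a b hab => ?_) fun f => ?_
  · have h := QuotientGroup.leftRel_apply.1 hab
    rw [Subgroup.mem_subgroupOf, Subgroup.coe_mul, Subgroup.coe_inv, inv_mul_mem_term_iff] at h
    exact funext fun w => h _ w.2.1
  · classical
    obtain ⟨g, hg, h⟩ := exists_label_eq K U hK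
      (fun w => if hw : w ∈ below U n then f ⟨w, hw⟩ else 1) n
    refine ⟨Quotient.mk _ ⟨g, hg⟩, funext fun w => ?_⟩
    change label g w.1 = f w
    rw [h _ w.2.2 w.2.1, dif_pos w.2]

/-- With U the set of all words and K the whole group, the upper and lower bounds coincide. -/
theorem index_term (n : ℕ) :
    ((TreeAut.levelFiltration (iteratedWreathProduct H)).term n).index =
      Nat.card H ^ (below (Set.univ : Set (List (Fin m))) n).ncard := by
  classical
  rw [← Subgroup.relIndex_top_right]
  refine le_antisymm (relIndex_le _ _ (by simp) n) (le_relIndex _ _ (fun u _ h => ?_) n)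
  refine ⟨ofPortrait fun w => if w = u then h else 1, Subgroup.mem_top _, ?_, by simp,
    fun w _ _ hw => by simp [hw]⟩
  rw [← one_mul (ofPortrait _), ← inv_one, inv_mul_mem_term_iff]
  intro v hv
  have : v ≠ u := fun h => by simp [h] at hv
  simp [this, label_one]

end IteratedWreath

/-! ### Hausdorff dimension of closed subgroups with respect to a filtration -/

namespace GroupFiltration

open Filter Topology MeasureTheory

variable {G : Type*} [Group G] (F : GroupFiltration G)

theorem mem_nhds_topology {g : G} {U : Set G} :
    U ∈ @nhds G F.topology g ↔ ∃ n, ∀ k ∈ F.term n, g * k ∈ U := by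
  let := F.topology
  rw [mem_nhds_iff]
  constructor
  · rintro ⟨V, hVU, hV, hg⟩
    obtain ⟨n, hn⟩ := hV g hg
    exact ⟨n, fun k hk => hVU (hn k hk)⟩
  · rintro ⟨n, hn⟩
    refine ⟨{x | g⁻¹ * x ∈ F.term n}, fun x hx => by simpa using hn _ hx, ?_, by simp⟩
    intro x hx
    exact ⟨n, fun k hk => by
      simpa [mul_assoc] using mul_mem (show g⁻¹ * x ∈ F.term n from hx) hk⟩

theorem isTopologicalGroup : @IsTopologicalGroup G F.topology _ := by
  let := F.topology
  have hn := F.normal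
  refine { continuous_mul := ?_, continuous_inv := ?_ }
  · refine continuous_iff_continuousAt.2 fun p U hU => ?_
    obtain ⟨n, hU⟩ := F.mem_nhds_topology.1 hU
    rw [mem_map, nhds_prod_eq, mem_prod_iff]
    refine ⟨{x | p.1⁻¹ * x ∈ F.term n}, F.mem_nhds_topology.2 ⟨n, fun k hk => by simpa using hk⟩,
      {x | p.2⁻¹ * x ∈ F.term n}, F.mem_nhds_topology.2 ⟨n, fun k hk => by simpa using hk⟩, ?_⟩
    rintro ⟨x, y⟩ ⟨hx, hy⟩
    have h1 := (hn n).conj_mem _ hx p.2⁻¹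
    have h2 := hU _ (mul_mem h1 hy)
    simpa [mul_assoc] using h2
  · refine continuous_iff_continuousAt.2 fun p U hU => ?_
    obtain ⟨n, hU⟩ := F.mem_nhds_topology.1 hU
    refine F.mem_nhds_topology.2 ⟨n, fun k hk => ?_⟩
    have h1 := (hn n).conj_mem _ (inv_mem hk) p
    have h2 := hU _ h1
    simpa [mul_assoc] using h2

theorem mul_inv_mem_term_iff {n : ℕ} {x y : G} : x * y⁻¹ ∈ F.term n ↔ x⁻¹ * y ∈ F.term n := by
  have hn := F.normal n
  rw [hn.mem_comm_iff, ← inv_mem_iff]; simp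

theorem distance_le {n : ℕ} {x y : G} (h : x⁻¹ * y ∈ F.term n) :
    F.distance x y ≤ ((F.term n).index : ℝ≥0∞)⁻¹ := by
  unfold distance
  split_ifs
  · exact zero_le
  · exact iInf₂_le n (F.mul_inv_mem_term_iff.2 h)

/-- Distances of distinct points are infima of inverse indices, so a strict inequality produces a
term of larger index, hence with larger subscript. This gain of one step makes `le_hdim` sharp. -/
theorem mem_term_of_distance_lt {n : ℕ} {x y : G}
    (h : F.distance x y < ((F.term n).index : ℝ≥0∞)⁻¹) : x⁻¹ * y ∈ F.term (n + 1) := by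
  unfold distance at h
  split_ifs at h with hxy
  · simp [hxy]
  · obtain ⟨i, hi⟩ := iInf_lt_iff.1 h
    obtain ⟨hxi, hi⟩ := iInf_lt_iff.1 hi
    rw [ENNReal.inv_lt_inv, Nat.cast_lt] at hi
    refine F.mul_inv_mem_term_iff.1 (F.antitone ?_ hxi)
    by_contra hlt
    have := F.finiteIndex n
    exact absurd (Subgroup.index_antitone (F.antitone (show i ≤ n by omega))) (by omega)

theorem tendsto_inv_index (hF : Tendsto (fun n => (F.term n).index) atTop atTop) :
    Tendsto (fun n => ((F.term n).index : ℝ≥0∞)⁻¹) atTop (𝓝 0) :=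
  ENNReal.tendsto_inv_nat_nhds_zero.comp hF

theorem topology_eq (hF : Tendsto (fun n => (F.term n).index) atTop atTop) :
    F.metric.toPseudoEMetricSpace.toUniformSpace.toTopologicalSpace = F.topology := by
  refine TopologicalSpace.ext_nhds fun g => Filter.ext fun U => ?_
  rw [F.mem_nhds_topology]
  let := F.metric
  rw [EMetric.mem_nhds_iff]
  constructor
  · rintro ⟨ε, hε, hU⟩
    obtain ⟨n, hn⟩ := ((F.tendsto_inv_index hF).eventually (gt_mem_nhds hε)).exists
    refine ⟨n, fun k hk => hU ?_⟩
    rw [Metric.mem_eball, edist_comm]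
    exact (F.distance_le (by simpa using hk)).trans_lt hn
  · rintro ⟨n, hn⟩
    have := F.finiteIndex n
    refine ⟨((F.term n).index : ℝ≥0∞)⁻¹, ENNReal.inv_pos.2 (ENNReal.natCast_ne_top _), ?_⟩
    intro x hx
    rw [Metric.mem_eball, edist_comm] at hx
    have := hn _ (F.antitone n.le_succ (F.mem_term_of_distance_lt hx))
    simpa using this

/-- The cosets of the n-th term cover K by relIndex many sets of diameter at most the inverse index,
so the a-dimensional Hausdorff measure of K is at most 1. -/
theorem hdim_le (hF : Tendsto (fun n => (F.term n).index) atTop atTop) (K : Subgroup G)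
    (a : NNReal) (h : ∀ n, ((F.term n).relIndex K : ℝ≥0∞) ≤ ((F.term n).index : ℝ≥0∞) ^ (a : ℝ)) :
    F.hdim K ≤ a := by
  let := F.metric
  let : MeasurableSpace G := borel G
  have : BorelSpace G := ⟨rfl⟩
  have hfin : ∀ n, ((F.term n).subgroupOf K).FiniteIndex := fun n => by
    have := F.finiteIndex n
    infer_instance
  have : ∀ n, Finite (K ⧸ (F.term n).subgroupOf K) := fun n => inferInstance
  let : ∀ n, Fintype (K ⧸ (F.term n).subgroupOf K) := fun n => Fintype.ofFinite _
  have hd : ∀ n, ∀ q : K ⧸ (F.term n).subgroupOf K,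
      Metric.ediam (Subtype.val '' {k : K | (k : K ⧸ (F.term n).subgroupOf K) = q}) ≤
        ((F.term n).index : ℝ≥0∞)⁻¹ := by
    refine fun n q => Metric.ediam_le ?_
    rintro _ ⟨x, hx, rfl⟩ _ ⟨y, hy, rfl⟩
    have hxy : (x : K ⧸ (F.term n).subgroupOf K) = y := hx.trans hy.symm
    have hmem := QuotientGroup.eq.1 hxy
    exact F.distance_le hmem
  refine dimH_le_of_hausdorffMeasure_ne_top (ne_top_of_le_ne_top ENNReal.one_ne_top
    ((Measure.hausdorffMeasure_le_liminf_sum (a : ℝ) (K : Set G) (l := atTop)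
      (fun n => ((F.term n).index : ℝ≥0∞)⁻¹) (F.tendsto_inv_index hF)
      (fun n (q : K ⧸ (F.term n).subgroupOf K) =>
        Subtype.val '' {k : K | (k : K ⧸ (F.term n).subgroupOf K) = q})
      (Eventually.of_forall hd) (Eventually.of_forall fun n x hx => ?_)).trans ?_))
  · exact Set.mem_iUnion.2 ⟨((⟨x, hx⟩ : K) : K ⧸ (F.term n).subgroupOf K), ⟨x, hx⟩, rfl, rfl⟩
  · refine liminf_le_of_frequently_le' (Eventually.frequently (Eventually.of_forall fun n => ?_))
    refine (Finset.sum_le_sum fun q _ => ENNReal.rpow_le_rpow (hd n q) a.2).trans ?_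
    rw [Finset.sum_const, Finset.card_univ, ← Nat.card_eq_fintype_card, nsmul_eq_mul,
      ENNReal.inv_rpow, ← div_eq_mul_inv]
    exact ENNReal.div_le_of_le_mul (by simpa [Subgroup.relIndex, Subgroup.index] using h n)

/-- A closed subgroup of a compact group carries a probability measure for which the cosets of every
term of the filtration have the expected mass. -/
theorem exists_measure (hc : @CompactSpace G F.topology) (K : Subgroup G)
    (hK : F.IsClosedSubgroup K) :
    ∃ μ : @Measure G (@borel G F.topology), μ (K : Set G) = 1 ∧
      ∀ n x, μ {y | x⁻¹ * y ∈ F.term n} ≤ ((F.term n).relIndex K : ℝ≥0∞)⁻¹ := by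
  let := F.topology
  have := F.isTopologicalGroup
  let : MeasurableSpace G := borel G
  have : BorelSpace G := ⟨rfl⟩
  have hKc : IsClosed (K : Set G) := hK
  have : CompactSpace K := isCompact_iff_compactSpace.1 hKc.isCompact
  let : MeasurableSpace K := borel K
  have : BorelSpace K := ⟨rfl⟩
  let ν : Measure K := Measure.haarMeasure ⊤
  have hν : ν Set.univ = 1 := Measure.haarMeasure_self
  have hval : Measurable (Subtype.val : K → G) := continuous_subtype_val.measurable
  have hopen : ∀ n x, IsOpen {y | x⁻¹ * y ∈ F.term n} := fun n x y hy =>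
    ⟨n, fun k hk => by
      simpa [mul_assoc] using mul_mem (show x⁻¹ * y ∈ F.term n from hy) hk⟩
  refine ⟨ν.map Subtype.val, ?_, fun n x => ?_⟩
  · rw [Measure.map_apply hval hKc.measurableSet]
    rwa [show (Subtype.val ⁻¹' (K : Set G) : Set K) = Set.univ from
      Set.eq_univ_of_forall fun k => k.2]
  · rw [Measure.map_apply hval (hopen n x).measurableSet]
    have hfin : ((F.term n).subgroupOf K).FiniteIndex := by
      have := F.finiteIndex n
      infer_instance
    let : Fintype (K ⧸ (F.term n).subgroupOf K) := Fintype.ofFinite _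
    have hset : ∀ k : K, (Subtype.val ⁻¹' {y | (k : G)⁻¹ * y ∈ F.term n} : Set K) =
        (fun y => k⁻¹ * y) ⁻¹' (Subtype.val ⁻¹' {y | y ∈ F.term n}) := fun k => rfl
    have hmeas : ∀ k : K, ν (Subtype.val ⁻¹' {y | (k : G)⁻¹ * y ∈ F.term n}) =
        ν (Subtype.val ⁻¹' {y | y ∈ F.term n}) := fun k => by
      rw [hset, measure_preimage_mul]
    -- The cosets in K are disjoint and have equal Haar mass, with total at most 1.
    have htotal : ((F.term n).relIndex K : ℝ≥0∞) * ν (Subtype.val ⁻¹' {y | y ∈ F.term n}) ≤ 1 := by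
      rw [← hν]
      have hdisj : Pairwise (Function.onFun Disjoint fun q : K ⧸ (F.term n).subgroupOf K =>
          (Subtype.val ⁻¹' {y | (q.out : G)⁻¹ * y ∈ F.term n} : Set K)) := by
        intro q q' hqq'
        refine Set.disjoint_left.2 fun y hy hy' => hqq' ?_
        rw [← q.out_eq', ← q'.out_eq']
        have h1 : ((q.out : K) : K ⧸ (F.term n).subgroupOf K) = y := QuotientGroup.eq.2 hy
        have h2 : ((q'.out : K) : K ⧸ (F.term n).subgroupOf K) = y := QuotientGroup.eq.2 hy'
        exact h1.trans h2.symm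
      have hu := measure_iUnion (μ := ν) hdisj fun q => hval (hopen n _).measurableSet
      rw [tsum_fintype, Finset.sum_congr rfl fun q _ => hmeas q.out, Finset.sum_const,
        Finset.card_univ, ← Nat.card_eq_fintype_card, nsmul_eq_mul] at hu
      exact hu.symm.le.trans (measure_mono (Set.subset_univ _))
    rw [ENNReal.le_inv_iff_mul_le, mul_comm]
    refine le_trans (mul_le_mul_right ?_ _) htotal
    -- A coset of the term either misses K or meets it in a single coset of the intersection.
    by_cases hx : ∃ k : K, x⁻¹ * k ∈ F.term n
    · obtain ⟨k, hk⟩ := hx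
      rw [← hmeas k]
      refine measure_mono fun y hy => ?_
      have := mul_mem (inv_mem hk) (show x⁻¹ * (y : G) ∈ F.term n from hy)
      simpa [mul_assoc] using this
    · rw [show (Subtype.val ⁻¹' {y | x⁻¹ * y ∈ F.term n} : Set K) = ∅ from
        Set.eq_empty_of_forall_notMem fun k hk => hx ⟨k, hk⟩]
      simp

/-- Mass distribution principle for the measure of `exists_measure`: up to the factor C, a set of
diameter d has mass at most d ^ a, so the a-dimensional measure of K is nonzero. -/
theorem le_hdim (hF : Tendsto (fun n => (F.term n).index) atTop atTop)
    (hc : @CompactSpace G F.topology) (K : Subgroup G) (hK : F.IsClosedSubgroup K)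
    (a C : NNReal) (ha : 0 < a) (hC : 0 < C)
    (h : ∀ n, ((F.term n).index : ℝ≥0∞) ^ (a : ℝ) ≤ C * (F.term n).relIndex K) :
    a ≤ F.hdim K := by
  have hexists := F.exists_measure hc K hK
  rw [← F.topology_eq hF] at hexists
  let := F.metric
  let : MeasurableSpace G := borel G
  have : BorelSpace G := ⟨rfl⟩
  obtain ⟨μ, hμK, hμ⟩ := hexists
  have hCtop : (C : ℝ≥0∞) ≠ ⊤ := ENNReal.coe_ne_top
  have hC0 : (C : ℝ≥0∞) ≠ 0 := ENNReal.coe_ne_zero.2 hC.ne'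
  have hball : ∀ n x, (C : ℝ≥0∞)⁻¹ * μ {y | x⁻¹ * y ∈ F.term n} ≤
      (((F.term n).index : ℝ≥0∞)⁻¹) ^ (a : ℝ) := by
    intro n x
    refine (mul_le_mul_right (hμ n x) _).trans ?_
    rw [ENNReal.inv_rpow, ← ENNReal.mul_inv (Or.inl hC0) (Or.inl hCtop), ENNReal.inv_le_inv]
    exact h n
  have hle : (C : ℝ≥0∞)⁻¹ • μ ≤ Measure.hausdorffMeasure (a : ℝ) := by
    refine Measure.le_hausdorffMeasure _ _ 1 one_pos fun s hs => ?_
    rw [Measure.smul_apply, smul_eq_mul]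
    rcases s.eq_empty_or_nonempty with rfl | ⟨x, hx⟩
    · simp
    have hsub : ∀ n, Metric.ediam s < ((F.term n).index : ℝ≥0∞)⁻¹ →
        s ⊆ {y | x⁻¹ * y ∈ F.term (n + 1)} := fun n hn y hy =>
      F.mem_term_of_distance_lt ((Metric.edist_le_ediam_of_mem hx hy).trans_lt hn)
    have hstep : ∀ n, Metric.ediam s < ((F.term n).index : ℝ≥0∞)⁻¹ →
        (C : ℝ≥0∞)⁻¹ * μ s ≤ (((F.term (n + 1)).index : ℝ≥0∞)⁻¹) ^ (a : ℝ) := fun n hn =>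
      (mul_le_mul_right (measure_mono (hsub n hn)) _).trans (hball _ _)
    -- For the least such n, the diameter lies strictly below the preceding inverse index, so s lies
    -- in one coset of the n-th term itself. If there is no such n, s lies in arbitrarily small
    -- cosets and has mass 0.
    by_cases hex : ∃ n, ((F.term n).index : ℝ≥0∞)⁻¹ ≤ Metric.ediam s
    · classical
      have hmin := Nat.find_spec hex
      rcases Nat.eq_zero_or_eq_succ_pred (Nat.find hex) with h0 | h0
      · rw [h0] at hmin
        refine le_trans ?_ (ENNReal.rpow_le_rpow hmin a.2)
        refine le_trans (mul_le_mul_right (measure_mono fun y _ => ?_) _) (hball 0 x)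
        simp [F.term_zero]
      · rw [h0] at hmin
        refine (hstep _ (not_le.1 (Nat.find_min hex
          (m := (Nat.find hex).pred) (by omega)))).trans (ENNReal.rpow_le_rpow hmin a.2)
    · push Not at hex
      have h0 : (C : ℝ≥0∞)⁻¹ * μ s ≤ 0 := by
        refine ge_of_tendsto' (x := atTop)
          (f := fun n => (((F.term (n + 1)).index : ℝ≥0∞)⁻¹) ^ (a : ℝ)) ?_ fun n => hstep n (hex n)
        have := ((F.tendsto_inv_index hF).comp (tendsto_add_atTop_nat 1)).ennrpow_const (a : ℝ)
        simpa [ENNReal.zero_rpow_of_pos (show (0 : ℝ) < a from ha)] using this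
      exact h0.trans zero_le
  refine le_dimH_of_hausdorffMeasure_ne_zero fun h0 => ?_
  have := hle (K : Set G)
  rw [h0, Measure.smul_apply, smul_eq_mul, hμK, mul_one] at this
  simp at this

end GroupFiltration

/-! ### Compactness, and automorphisms copied below an antichain -/

namespace IteratedWreath

variable {m : ℕ} {H : Subgroup (Equiv.Perm (Fin m))}

/-- The iterated wreath product is compact, being a continuous image of the space of portraits. -/
theorem compactSpace :
    @CompactSpace _ (TreeAut.levelFiltration (iteratedWreathProduct H)).topology := by
  let := (TreeAut.levelFiltration (iteratedWreathProduct H)).topology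
  let : TopologicalSpace H := ⊥
  have : DiscreteTopology H := ⟨rfl⟩
  have hcont : Continuous (ofPortrait (H := H)) := by
    refine continuous_iff_continuousAt.2 fun l U hU => ?_
    obtain ⟨n, hn⟩ := (GroupFiltration.mem_nhds_topology _).1 hU
    have hev : ∀ᶠ l' in nhds l, ∀ w ∈ {w : List (Fin m) | w.length < n}, l' w = l w :=
      (Filter.eventually_all_finite (List.finite_length_lt (Fin m) n)).2 fun w _ =>
        (continuous_apply w).continuousAt.eventually
          (Filter.eventually_of_mem ((isOpen_discrete {l w}).mem_nhds rfl) fun _ h => h)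
    refine Filter.mem_map.2 (Filter.mem_of_superset hev fun l' hl' => ?_)
    have := hn ((ofPortrait l)⁻¹ * ofPortrait l') (inv_mul_mem_term_iff.2 fun v hv => by
      simpa using (hl' v hv).symm)
    simpa using this
  have hsurj : Function.Surjective (ofPortrait (H := H)) := fun g =>
    ⟨label g, ext_label fun v => by simp⟩
  exact ⟨hsurj.range_eq ▸ isCompact_range hcont⟩

/-! ### Copies of an automorphism below the vertices of an antichain -/

/-- No element of `V` is a proper prefix of another one. -/
def PrefixFree (V : Set (List (Fin m))) : Prop := ∀ u ∈ V, ∀ v ∈ V, u <+: v → u = v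

open Classical in
/-- The action of `g` below every vertex of `V`. -/
noncomputable def spreadAct (g : iteratedWreathProduct H) :
    Set (List (Fin m)) → List (Fin m) → List (Fin m)
  | _, [] => []
  | V, x :: w => if [] ∈ V then g • (x :: w) else x :: spreadAct g {u | x :: u ∈ V} w

theorem spreadAct_append (g : iteratedWreathProduct H) {V : Set (List (Fin m))}
    (hV : PrefixFree V) {u : List (Fin m)} (hu : u ∈ V) (w : List (Fin m)) :
    spreadAct g V (u ++ w) = u ++ g • w := by
  induction u generalizing V with
  | nil => cases w <;> simp [spreadAct, smul_nil, hu]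
  | cons x u ih =>
    have h0 : [] ∉ V := fun h => by simpa using hV _ h _ hu (List.nil_prefix)
    rw [List.cons_append, spreadAct, if_neg h0, ih (V := {u | x :: u ∈ V}) _ hu]
    · rfl
    · intro a ha b hb hab
      simpa using hV _ ha _ hb (List.cons_prefix_cons.2 ⟨rfl, hab⟩)

theorem spreadAct_of_forall (g : iteratedWreathProduct H) {V : Set (List (Fin m))}
    {w : List (Fin m)} (h : ∀ u ∈ V, ¬ u <+: w) : spreadAct g V w = w := by
  induction w generalizing V with
  | nil => rfl
  | cons x w ih =>
    rw [spreadAct, if_neg fun h0 => h _ h0 List.nil_prefix, ih]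
    exact fun u hu huw => h _ hu (List.cons_prefix_cons.2 ⟨rfl, huw⟩)

theorem spreadAct_of_forall_eq (g : iteratedWreathProduct H) {V : Set (List (Fin m))}
    (hV : PrefixFree V) {w : List (Fin m)} (h : ∀ u ∈ V, u <+: w → u = w) :
    spreadAct g V w = w := by
  by_cases hw : w ∈ V
  · simpa [smul_nil] using spreadAct_append g hV hw []
  · exact spreadAct_of_forall g fun u hu huw => hw (h u hu huw ▸ hu)

theorem exists_spread (g : iteratedWreathProduct H) {V : Set (List (Fin m))}
    (hV : PrefixFree V) :
    ∃ k : iteratedWreathProduct H, ∀ v : List (Fin m), k • v = spreadAct g V v := by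
  refine exists_of_labels _ rfl fun v => ?_
  by_cases hv : ∃ u ∈ V, u <+: v
  · obtain ⟨u, hu, w, rfl⟩ := hv
    refine ⟨label g w, (label g w).2, fun x => ?_⟩
    rw [List.append_assoc, spreadAct_append g hV hu, spreadAct_append g hV hu, smul_concat,
      List.append_assoc]
  -- Even if v ++ [x] lies in V it is fixed, because a copy of g fixes the vertex it hangs from.
  · refine ⟨1, H.one_mem, fun x => ?_⟩
    rw [spreadAct_of_forall g (fun u hu huv => hv ⟨u, hu, huv⟩), spreadAct_of_forall_eq g hV]
    · rfl
    · intro u hu huv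
      rcases List.prefix_concat_iff.1 huv with h | h
      · simpa using h
      · exact absurd ⟨u, hu, h⟩ hv

/-- The homomorphism placing a copy of `g` below every vertex of a prefix-free set. -/
noncomputable def spread (V : Set (List (Fin m))) (hV : PrefixFree V) :
    iteratedWreathProduct H →* iteratedWreathProduct H :=
  MonoidHom.mk' (fun g => (exists_spread g hV).choose) fun g k => by
    refine Subtype.ext (Subtype.ext (Equiv.ext fun v => ?_))
    change (exists_spread (g * k) hV).choose • v =
      ((exists_spread g hV).choose * (exists_spread k hV).choose) • v
    rw [mul_smul, (exists_spread (g * k) hV).choose_spec, (exists_spread g hV).choose_spec,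
      (exists_spread k hV).choose_spec]
    by_cases hv : ∃ u ∈ V, u <+: v
    · obtain ⟨u, hu, w, rfl⟩ := hv
      simp only [spreadAct_append _ hV hu, mul_smul]
    · push Not at hv
      simp only [spreadAct_of_forall _ hv]

theorem spread_smul_append {V : Set (List (Fin m))} (hV : PrefixFree V)
    (g : iteratedWreathProduct H) {u : List (Fin m)} (hu : u ∈ V) (w : List (Fin m)) :
    spread V hV g • (u ++ w) = u ++ g • w :=
  ((exists_spread g hV).choose_spec _).trans (spreadAct_append g hV hu w)

theorem spread_smul_of_forall {V : Set (List (Fin m))} (hV : PrefixFree V)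
    (g : iteratedWreathProduct H) {w : List (Fin m)} (h : ∀ u ∈ V, u <+: w → u = w) :
    spread V hV g • w = w :=
  ((exists_spread g hV).choose_spec _).trans (spreadAct_of_forall_eq g hV h)

/-! ### Rooted automorphisms and odometers -/

theorem portraitAct_one (v : List (Fin m)) :
    portraitAct (fun _ : List (Fin m) => (1 : H)) v = v := by
  induction v with
  | nil => rfl
  | cons x v ih => simp [portraitAct, ih]

/-- The automorphism permuting the first letter. -/
noncomputable def rooted (h : H) : iteratedWreathProduct H :=
  ofPortrait fun w => if w = [] then h else 1

theorem rooted_smul_cons (h : H) (x : Fin m) (w : List (Fin m)) :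
    rooted h • (x :: w) = h.1 x :: w := by
  simp [rooted, ofPortrait_smul, portraitAct, portraitAct_one]

/-- The automorphism with label `h` along the ray `z z z …` and trivial labels elsewhere. -/
noncomputable def odometer (z : Fin m) (h : H) : iteratedWreathProduct H :=
  ofPortrait fun w => if ∀ x ∈ w, x = z then h else 1

theorem odometer_smul_cons (z : Fin m) (h : H) (x : Fin m) (w : List (Fin m)) :
    odometer z h • (x :: w) = h.1 x :: if x = z then odometer z h • w else w := by
  simp only [odometer, ofPortrait_smul, portraitAct]
  by_cases hx : x = z
  · simp [hx]
  · simp [hx, portraitAct_one]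

/-- The group generated by all odometers along a fixed ray. -/
def odometerGroup (H : Subgroup (Equiv.Perm (Fin m))) (z : Fin m) :
    Subgroup (iteratedWreathProduct H) :=
  Subgroup.closure (Set.range (odometer z))

/-- Self-replication. If h moves z, following the odometer of h by that of h⁻¹ brings the first
letter back to z without touching the subtree again, since the second odometer acts nontrivially
only below z. -/
theorem odometerGroup_exists_section (z : Fin m) {t : iteratedWreathProduct H}
    (ht : t ∈ odometerGroup H z) :
    ∃ s ∈ odometerGroup H z, ∀ w : List (Fin m), s • (z :: w) = z :: t • w := by
  induction ht using Subgroup.closure_induction with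
  | mem t ht =>
    obtain ⟨h, rfl⟩ := ht
    by_cases hz : h.1 z = z
    · exact ⟨odometer z h, Subgroup.subset_closure ⟨h, rfl⟩, fun w => by
        simp [odometer_smul_cons, hz]⟩
    · exact ⟨odometer z h⁻¹ * odometer z h, mul_mem (Subgroup.subset_closure ⟨_, rfl⟩)
        (Subgroup.subset_closure ⟨_, rfl⟩), fun w => by
        simp [mul_smul, odometer_smul_cons, hz]⟩
  | one => exact ⟨1, one_mem _, by simp⟩
  | mul a b _ _ ha hb =>
    obtain ⟨s, hs, hs'⟩ := ha
    obtain ⟨t, ht, ht'⟩ := hb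
    exact ⟨s * t, mul_mem hs ht, fun w => by simp [mul_smul, hs', ht']⟩
  | inv a _ ha =>
    obtain ⟨s, hs, hs'⟩ := ha
    exact ⟨s⁻¹, inv_mem hs, fun w => by rw [inv_smul_eq_iff, hs', smul_inv_smul]⟩

/-- One odometer brings the first letter to z by transitivity of H. Self-replication then lets the
induction continue below z. -/
theorem odometerGroup_exists_smul_eq_replicate (hH : MulAction.IsPretransitive H (Fin m))
    (z : Fin m) (n : ℕ) (w : List (Fin m)) (hw : w.length = n) :
    ∃ t ∈ odometerGroup H z, t • w = List.replicate n z := by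
  induction n generalizing w with
  | zero => exact ⟨1, one_mem _, by simpa using hw⟩
  | succ n ih =>
    obtain ⟨x, w, rfl⟩ := List.exists_of_length_succ w hw
    obtain ⟨h, hh⟩ := hH.exists_smul_eq x z
    have hhx : h.1 x = z := hh
    obtain ⟨w', hw', hl⟩ : ∃ w', odometer z h • (x :: w) = z :: w' ∧ w'.length = n := by
      refine ⟨_, by rw [odometer_smul_cons, hhx], ?_⟩
      split_ifs <;> simpa [length_smul] using hw
    obtain ⟨t, ht, htw⟩ := ih w' hl
    obtain ⟨s, hs, hs'⟩ := odometerGroup_exists_section z ht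
    exact ⟨s * odometer z h, mul_mem hs (Subgroup.subset_closure ⟨h, rfl⟩), by
      rw [mul_smul, hw', hs', htw, List.replicate_succ]⟩

theorem odometerGroup_exists_smul_eq (hH : MulAction.IsPretransitive H (Fin m))
    (z : Fin m) {v w : List (Fin m)} (h : v.length = w.length) :
    ∃ t ∈ odometerGroup H z, t • v = w := by
  obtain ⟨t, ht, htv⟩ := odometerGroup_exists_smul_eq_replicate hH z _ v h
  obtain ⟨s, hs, hsw⟩ := odometerGroup_exists_smul_eq_replicate hH z _ w rfl
  exact ⟨s⁻¹ * t, mul_mem (inv_mem hs) ht, by rw [mul_smul, htv, ← hsw, inv_smul_smul]⟩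

/-- The label at the root, as a homomorphism. -/
noncomputable def rootLabel : iteratedWreathProduct H →* H :=
  MonoidHom.mk' (fun g => label g []) fun g k => by rw [label_mul, smul_nil]

theorem smul_singleton (g : iteratedWreathProduct H) (x : Fin m) :
    g • [x] = [(rootLabel g).1 x] := by
  have := smul_concat g [] x
  rwa [smul_nil] at this

theorem rootLabel_odometer (z : Fin m) (h : H) : rootLabel (odometer z h) = h := by
  change label (odometer z h) [] = h
  simp [odometer]

/-! ### The odometer of σ as an adding machine -/

theorem odometer_pow_smul_cons (z : Fin m) (σ : H) (j : ℕ) (hj : j < MulAction.period σ z)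
    (w : List (Fin m)) :
    odometer z σ ^ (j + 1) • (z :: w) = (σ ^ (j + 1)).1 z :: odometer z σ • w := by
  induction j with
  | zero => simp [odometer_smul_cons]
  | succ j ih =>
    have hne : (σ ^ (j + 1)).1 z ≠ z := fun h => by
      have := MulAction.pow_smul_eq_iff_period_dvd.1 (show σ ^ (j + 1) • z = z from h)
      exact absurd (Nat.le_of_dvd (by omega) this) (by omega)
    rw [pow_succ', mul_smul, ih (by omega), odometer_smul_cons, if_neg hne]
    simp [pow_succ' σ (j + 1)]

/-- During one period of z under σ, only the first step starts at the letter z and acts on the tail.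
The period-th power therefore acts below z as one odometer step. -/
theorem odometer_zpow_smul_cons (z : Fin m) (σ : H) (k : ℤ) (w : List (Fin m)) :
    odometer z σ ^ ((MulAction.period σ z : ℤ) * k) • (z :: w) =
      z :: odometer z σ ^ k • w := by
  have hr : 0 < MulAction.period σ z := MulAction.period_pos_of_orderOf_pos (orderOf_pos σ) z
  have h1 : ∀ w : List (Fin m), odometer z σ ^ MulAction.period σ z • (z :: w) =
      z :: odometer z σ • w := fun w => by
    have h := odometer_pow_smul_cons z σ (MulAction.period σ z - 1) (by omega) w
    rw [Nat.sub_add_cancel hr] at h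
    rw [h]
    congr 1
    exact MulAction.pow_period_smul σ z
  rw [zpow_mul, zpow_natCast]
  induction k using Int.induction_on with
  | zero => simp
  | succ k ih => rw [add_comm, zpow_one_add, mul_smul, ih, h1, zpow_one_add, mul_smul]
  | pred k ih =>
    rw [sub_eq_neg_add, zpow_add, mul_smul, ih, zpow_add, mul_smul, zpow_neg_one, zpow_neg_one,
      inv_smul_eq_iff, h1, smul_inv_smul]

theorem odometer_zpow_smul_replicate_iff (z : Fin m) (σ : H) (l : ℕ) (k : ℤ) :
    odometer z σ ^ k • List.replicate l z = List.replicate l z ↔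
      ((MulAction.period σ z : ℤ) ^ l) ∣ k := by
  have hr : 0 < MulAction.period σ z := MulAction.period_pos_of_orderOf_pos (orderOf_pos σ) z
  induction l generalizing k with
  | zero => simp [smul_nil]
  | succ l ih =>
    constructor
    · intro h
      have h1 : odometer z σ ^ k • [z] = [z] := by
        have := congrArg (List.take 1) h
        rwa [take_smul] at this
      rw [smul_singleton, map_zpow, rootLabel_odometer, List.singleton_inj] at h1
      obtain ⟨k, rfl⟩ := MulAction.zpow_smul_eq_iff_period_dvd.1 (show σ ^ k • z = z from h1)
      rw [List.replicate_succ, odometer_zpow_smul_cons, List.cons_inj_right] at h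
      rw [pow_succ']
      exact mul_dvd_mul_left _ ((ih k).1 h)
    · rintro ⟨k, rfl⟩
      rw [pow_succ', mul_assoc, List.replicate_succ, odometer_zpow_smul_cons,
        (ih _).2 (dvd_mul_right _ _)]

end IteratedWreath

/-! ### Positions of the generators

A pair `(v, n)` is coded by an integer whose base-`r` digits are supported on two even places. The
codes and their shifts by one place can be told apart modulo small powers of `r`. -/

namespace IteratedWreath

/-- Uniqueness of the low base-r digits for numbers with digits 0 and 1, by induction on the place.
-/
theorem mem_iff_of_sum_pow_modEq {r : ℕ} (hr : 2 ≤ r) {S S' : Finset ℕ} {L : ℕ}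
    (h : ((r : ℤ) ^ L) ∣ ∑ t ∈ S, (r : ℤ) ^ t - ∑ t ∈ S', (r : ℤ) ^ t) {t : ℕ} (ht : t < L) :
    t ∈ S ↔ t ∈ S' := by
  induction t using Nat.strong_induction_on with
  | _ t ih =>
    by_contra hne
    have key : ∀ A : Finset ℕ, (r : ℤ) ^ (t + 1) ∣ ∑ i ∈ A, (r : ℤ) ^ i -
        (∑ i ∈ A with i < t, (r : ℤ) ^ i + if t ∈ A then (r : ℤ) ^ t else 0) := by
      intro A
      have hA : ∑ i ∈ A, (r : ℤ) ^ i = ∑ i ∈ A with i < t, (r : ℤ) ^ i +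
          ∑ i ∈ A with ¬ i < t, (r : ℤ) ^ i := (Finset.sum_filter_add_sum_filter_not _ _ _).symm
      have hB : ∑ i ∈ A with ¬ i < t, (r : ℤ) ^ i =
          (if t ∈ A then (r : ℤ) ^ t else 0) + ∑ i ∈ A with t < i, (r : ℤ) ^ i := by
        have : A.filter (fun i => ¬ i < t) = A.filter (fun i => i = t) ∪ A.filter (t < ·) := by
          ext i; simp only [Finset.mem_filter, Finset.mem_union]; grind
        rw [this, Finset.sum_union, Finset.filter_eq']
        · split_ifs <;> simp
        · rw [Finset.disjoint_filter]; omega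
      rw [hA, hB, ← add_assoc, add_sub_cancel_left]
      refine Finset.dvd_sum fun i hi => pow_dvd_pow _ (Finset.mem_filter.1 hi).2
    have hlow : ∑ i ∈ S with i < t, (r : ℤ) ^ i = ∑ i ∈ S' with i < t, (r : ℤ) ^ i := by
      refine Finset.sum_congr (Finset.ext fun i => ?_) fun _ _ => rfl
      simp only [Finset.mem_filter]
      exact ⟨fun hi => ⟨(ih i hi.2 (by omega)).1 hi.1, hi.2⟩,
        fun hi => ⟨(ih i hi.2 (by omega)).2 hi.1, hi.2⟩⟩
    have h1 := dvd_sub ((pow_dvd_pow (r : ℤ) (show t + 1 ≤ L by omega)).trans h)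
      (dvd_sub (key S) (key S'))
    rw [hlow] at h1
    have h2 : (r : ℤ) ^ (t + 1) ∣ r ^ t := by
      by_cases hS : t ∈ S <;> by_cases hS' : t ∈ S'
      · exact absurd (iff_of_true hS hS') hne
      · simp only [hS, hS', if_true, if_false] at h1
        refine (Int.dvd_iff_dvd_of_dvd_sub ?_).1 h1; ring_nf; exact dvd_zero _
      · simp only [hS, hS', if_true, if_false] at h1
        rw [← dvd_neg]
        refine (Int.dvd_iff_dvd_of_dvd_sub ?_).1 h1; ring_nf; exact dvd_zero _
      · exact absurd (iff_of_false hS hS') hne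
    have h3 := (Nat.pow_dvd_pow_iff_le_right (x := r) (by omega)).1
      (show r ^ (t + 1) ∣ r ^ t by exact_mod_cast h2)
    omega

/-- The two-digit codes used to place the generators. -/
def code (r : ℕ) (s : ℕ × ℕ) : ℤ := (r : ℤ) ^ (2 * s.1) + (r : ℤ) ^ (2 * s.2)

/-- Codes occupy even places and their multiples by r odd places. Comparing code s' + r * code s
with code s'' + r * code s', the even digits give s' = s'' and the odd ones s = s'. The exponent 2 *
n + 2 is just large enough to include the odd place 2 * n + 1. -/
theorem code_separated {r : ℕ} (hr : 2 ≤ r) {s s' s'' : ℕ × ℕ} (hs : s.1 < s.2)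
    (hs' : s'.1 < s'.2) (hs'' : s''.1 < s''.2)
    (h : (r : ℤ) ^ min (2 * s'.2 + 2) (2 * s''.2 + 2) ∣
      code r s' + r * code r s - r * code r s' - code r s'') : s = s' ∧ s' = s'' := by
  have hA : ∀ a b : ℕ × ℕ, a.1 < a.2 → b.1 < b.2 →
      ∑ t ∈ ({2 * a.1, 2 * a.2, 2 * b.1 + 1, 2 * b.2 + 1} : Finset ℕ), (r : ℤ) ^ t =
        code r a + r * code r b := by
    intro a b ha hb
    rw [Finset.sum_insert, Finset.sum_insert, Finset.sum_insert, Finset.sum_singleton]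
    · simp only [code]; ring
    all_goals simp; try omega
  have h1 : (r : ℤ) ^ min (2 * s'.2 + 2) (2 * s''.2 + 2) ∣
      ∑ t ∈ ({2 * s'.1, 2 * s'.2, 2 * s.1 + 1, 2 * s.2 + 1} : Finset ℕ), (r : ℤ) ^ t -
      ∑ t ∈ ({2 * s''.1, 2 * s''.2, 2 * s'.1 + 1, 2 * s'.2 + 1} : Finset ℕ), (r : ℤ) ^ t := by
    rw [hA _ _ hs' hs, hA _ _ hs'' hs']
    convert h using 1; ring
  have h2 := fun t (ht : t < min (2 * s'.2 + 2) (2 * s''.2 + 2)) =>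
    mem_iff_of_sum_pow_modEq hr h1 ht
  simp only [Finset.mem_insert, Finset.mem_singleton] at h2
  obtain ⟨i, n⟩ := s
  obtain ⟨i', n'⟩ := s'
  obtain ⟨i'', n''⟩ := s''
  simp only [Prod.mk.injEq] at *
  -- Both even digits of the pair with the smaller second entry are visible modulo this power, and
  -- two distinct places determine the pair.
  have e1 : i' = i'' ∧ n' = n'' := by
    rcases le_total n' n'' with hn | hn
    · have a := h2 (2 * i') (by omega)
      have b := h2 (2 * n') (by omega)
      omega
    · have a := h2 (2 * i'') (by omega)
      have b := h2 (2 * n'') (by omega)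
      omega
  obtain ⟨rfl, rfl⟩ := e1
  have a := h2 (2 * i' + 1) (by omega)
  have b := h2 (2 * n' + 1) (by omega)
  omega

/-! ### Sparse vertex sets separated by their codes -/

variable {m : ℕ} {H : Subgroup (Equiv.Perm (Fin m))}

theorem PrefixFree.eq_of_prefix {A : Set (List (Fin m))} (hA : PrefixFree A)
    {v v' a a' w : List (Fin m)} (hv : v ∈ A) (hv' : v' ∈ A) (h : v ++ a <+: w)
    (h' : v' ++ a' <+: w) : v = v' ∧ (a <+: a' ∨ a' <+: a) := by
  have h1 : v = v' := by
    rcases List.prefix_or_prefix_of_prefix ((List.prefix_append v a).trans h)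
      ((List.prefix_append v' a').trans h') with h2 | h2
    · exact hA _ hv _ hv' h2
    · exact (hA _ hv' _ hv h2).symm
  subst h1
  refine ⟨rfl, ?_⟩
  simpa [List.prefix_append_right_inj] using List.prefix_or_prefix_of_prefix h h'

/-- The vertex coded by the pair `(v, n)`. -/
noncomputable def position (z : Fin m) (σ : H) (v : List (Fin m)) (n : ℕ) : List (Fin m) :=
  odometer z σ ^ code (MulAction.period σ z) (Encodable.encode v, n) •
    List.replicate (2 * n + 2) z

/-- The exponent of the odometer that isolates the pair `(v, n)`. -/
noncomputable def shift (z : Fin m) (σ : H) (v : List (Fin m)) (n : ℕ) : ℤ :=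
  MulAction.period σ z * code (MulAction.period σ z) (Encodable.encode v, n)

theorem length_position (z : Fin m) (σ : H) (v : List (Fin m)) (n : ℕ) :
    (position z σ v n).length = 2 * n + 2 := by
  simp [position, length_smul]

/-- The orbit of the word z … z of length l under the odometer has r ^ l elements, so comparable
words have congruent exponents. -/
theorem pow_min_dvd_of_prefix (z : Fin m) (σ : H) {a b : ℤ} {l l' : ℕ}
    (h : odometer z σ ^ a • List.replicate l z <+: odometer z σ ^ b • List.replicate l' z) :
    (MulAction.period σ z : ℤ) ^ min l l' ∣ a - b := by
  have hl : l ≤ l' := by simpa [length_smul] using h.length_le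
  rw [min_eq_left hl, ← odometer_zpow_smul_replicate_iff, sub_eq_neg_add, zpow_add, mul_smul,
    zpow_neg, inv_smul_eq_iff]
  rw [List.prefix_iff_eq_take, take_smul, List.take_replicate] at h
  simpa [length_smul, hl] using h

theorem two_le_period {z : Fin m} {σ : H} (hσ : σ.1 z ≠ z) : 2 ≤ MulAction.period σ z := by
  have h0 : 0 < MulAction.period σ z := MulAction.period_pos_of_orderOf_pos (orderOf_pos σ) z
  have h1 : MulAction.period σ z ≠ 1 := fun h => hσ (MulAction.period_eq_one_iff.1 h)
  omega

/-- Here the shift of (v, n) is r times its code. The shifted position of (v', n') is comparable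
with another position only in the trivial case where all three pairs agree; this is what
`code_separated` says about exponents. -/
theorem position_separated {z : Fin m} {σ : H} (hσ : σ.1 z ≠ z) {v v' v'' : List (Fin m)}
    {n n' n'' : ℕ} (hn : Encodable.encode v < n) (hn' : Encodable.encode v' < n')
    (hn'' : Encodable.encode v'' < n'')
    (h : odometer z σ ^ (shift z σ v n - shift z σ v' n') • position z σ v' n' <+:
        position z σ v'' n'' ∨
      position z σ v'' n'' <+:
        odometer z σ ^ (shift z σ v n - shift z σ v' n') • position z σ v' n') :
    (v = v' ∧ n = n') ∧ v' = v'' ∧ n' = n'' := by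
  have key : (MulAction.period σ z : ℤ) ^ min (2 * n' + 2) (2 * n'' + 2) ∣
      shift z σ v n - shift z σ v' n' + code (MulAction.period σ z) (Encodable.encode v', n') -
        code (MulAction.period σ z) (Encodable.encode v'', n'') := by
    simp only [position, ← mul_smul, ← zpow_add] at h
    rcases h with h | h
    · exact pow_min_dvd_of_prefix z σ h
    · rw [min_comm, ← dvd_neg, neg_sub]
      exact pow_min_dvd_of_prefix z σ h
  have := code_separated (two_le_period hσ) (s := (Encodable.encode v, n))
    (s' := (Encodable.encode v', n')) (s'' := (Encodable.encode v'', n'')) hn hn' hn'' (by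
      refine key.trans (dvd_of_eq ?_)
      simp only [shift]; ring)
  simpa using this

theorem position_eq_of_prefix {z : Fin m} {σ : H} (hσ : σ.1 z ≠ z) {v v' : List (Fin m)}
    {n n' : ℕ} (hn : Encodable.encode v < n) (hn' : Encodable.encode v' < n')
    (h : position z σ v n <+: position z σ v' n' ∨ position z σ v' n' <+: position z σ v n) :
    v = v' ∧ n = n' :=
  (position_separated hσ hn hn hn' (by simpa using h)).2

/-- The positions below the vertices of `A`. -/
def positions (z : Fin m) (σ : H) (A : Set (List (Fin m))) : Set (List (Fin m)) :=
  {w | ∃ v ∈ A, ∃ n, Encodable.encode v < n ∧ w = v ++ position z σ v n}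

/-- The children in direction `z` of the positions below the vertices of `A`. -/
def childPositions (z : Fin m) (σ : H) (A : Set (List (Fin m))) : Set (List (Fin m)) :=
  {w | ∃ v ∈ A, ∃ n, Encodable.encode v < n ∧ w = v ++ (position z σ v n ++ [z])}

/-- Shifted copies of deep vertices below the positions. -/
def shiftedPositions (z : Fin m) (σ : H) (A : Set (List (Fin m))) (e : ℕ) :
    Set (List (Fin m)) :=
  {w | ∃ v ∈ A, ∃ n, Encodable.encode v < n ∧ w = v ++ odometer z σ ^ (-shift z σ v n) •
    (position z σ v n ++ List.replicate (2 * n + e + 1) z)}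

theorem prefixFree_positions {z : Fin m} {σ : H} (hσ : σ.1 z ≠ z) {A : Set (List (Fin m))}
    (hA : PrefixFree A) : PrefixFree (positions z σ A) := by
  rintro _ ⟨v, hv, n, hn, rfl⟩ _ ⟨v', hv', n', hn', rfl⟩ h
  obtain ⟨rfl, h1⟩ := hA.eq_of_prefix hv hv' h List.prefix_rfl
  obtain ⟨-, rfl⟩ := position_eq_of_prefix hσ hn hn' h1
  rfl

theorem prefix_or_prefix_of_append {a b c d : List (Fin m)}
    (h : a ++ b <+: c ++ d ∨ c ++ d <+: a ++ b) : a <+: c ∨ c <+: a := by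
  rcases h with h | h
  · exact List.prefix_or_prefix_of_prefix ((List.prefix_append a b).trans h)
      (List.prefix_append c d)
  · exact List.prefix_or_prefix_of_prefix (List.prefix_append a b)
      ((List.prefix_append c d).trans h)

theorem prefixFree_childPositions {z : Fin m} {σ : H} (hσ : σ.1 z ≠ z)
    {A : Set (List (Fin m))} (hA : PrefixFree A) : PrefixFree (childPositions z σ A) := by
  rintro _ ⟨v, hv, n, hn, rfl⟩ _ ⟨v', hv', n', hn', rfl⟩ h
  obtain ⟨rfl, h1⟩ := hA.eq_of_prefix hv hv' h List.prefix_rfl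
  obtain ⟨-, rfl⟩ := position_eq_of_prefix hσ hn hn' (prefix_or_prefix_of_append h1)
  rfl

theorem shifted_separated {z : Fin m} {σ : H} (hσ : σ.1 z ≠ z) {v v' v'' : List (Fin m)}
    {n n' n'' : ℕ} (hn : Encodable.encode v < n) (hn' : Encodable.encode v' < n')
    (hn'' : Encodable.encode v'' < n'') {a b : List (Fin m)}
    (h : odometer z σ ^ shift z σ v n •
        (odometer z σ ^ (-shift z σ v' n') • (position z σ v' n' ++ a)) <+:
        position z σ v'' n'' ++ b ∨
      position z σ v'' n'' ++ b <+: odometer z σ ^ shift z σ v n •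
        (odometer z σ ^ (-shift z σ v' n') • (position z σ v' n' ++ a))) :
    (v = v' ∧ n = n') ∧ v' = v'' ∧ n' = n'' := by
  rw [← mul_smul, ← zpow_add, ← sub_eq_add_neg] at h
  obtain ⟨t, -, ht⟩ := smul_append_eq
    (odometer z σ ^ (shift z σ v n - shift z σ v' n')) (position z σ v' n') a
  rw [ht] at h
  exact position_separated hσ hn hn' hn'' (prefix_or_prefix_of_append h)

theorem prefixFree_shiftedPositions {z : Fin m} {σ : H} (hσ : σ.1 z ≠ z)
    {A : Set (List (Fin m))} (hA : PrefixFree A) (e : ℕ) :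
    PrefixFree (shiftedPositions z σ A e) := by
  rintro _ ⟨v, hv, n, hn, rfl⟩ _ ⟨v', hv', n', hn', rfl⟩ h
  obtain ⟨rfl, h1⟩ := hA.eq_of_prefix hv hv' h List.prefix_rfl
  obtain ⟨⟨-, rfl⟩, -⟩ := shifted_separated hσ hn hn' hn
    (a := List.replicate (2 * n' + e + 1) z) (b := List.replicate (2 * n + e + 1) z) (by
      rw [or_comm, ← smul_prefix_smul_iff (odometer z σ ^ (-shift z σ v n)),
        ← smul_prefix_smul_iff (odometer z σ ^ (-shift z σ v n)) (v := _ ++ _)]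
      rw [zpow_neg _ (shift z σ v n), inv_smul_smul, ← zpow_neg]
      exact h1)
  rfl

/-! ### Isolating labels -/

theorem label_inv_smul (q : iteratedWreathProduct H) (u : List (Fin m)) :
    label q⁻¹ (q • u) = (label q u)⁻¹ := by
  rw [eq_inv_iff_mul_eq_one, ← label_mul, inv_mul_cancel, label_one]

theorem label_conj (q s : iteratedWreathProduct H) {u : List (Fin m)} (hs : s • u = u) :
    label (q * s * q⁻¹) (q • u) = label q u * label s u * (label q u)⁻¹ := by
  rw [label_mul, label_mul, inv_smul_smul, hs, label_inv_smul]

/-- At level `N` the group `K` realizes every label at `u`, with no other label except at `w`. -/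
def Isolates (K : Subgroup (iteratedWreathProduct H)) (N : ℕ) (u w : List (Fin m)) : Prop :=
  ∀ h : H, ∃ s ∈ K, s ∈ (TreeAut.levelFiltration (iteratedWreathProduct H)).term N ∧
    label s u = h ∧ ∀ u' : List (Fin m), u'.length = N → u' ≠ u → u' ≠ w → label s u' = 1

theorem Isolates.smul {K : Subgroup (iteratedWreathProduct H)} {N : ℕ} {u w : List (Fin m)}
    (h : Isolates K N u w) (hu : u.length = N) {q : iteratedWreathProduct H} (hq : q ∈ K) :
    Isolates K N (q • u) (q • w) := by
  intro k
  obtain ⟨s, hsK, hs, hl, hl'⟩ := h ((label q u)⁻¹ * k * label q u)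
  refine ⟨q * s * q⁻¹, K.mul_mem (K.mul_mem hq hsK) (K.inv_mem hq),
    ((TreeAut.levelFiltration (iteratedWreathProduct H)).normal N).conj_mem s hs q, ?_,
    fun u' hu' h1 h2 => ?_⟩
  · rw [label_conj q s (smul_eq_of_mem_term hs hu.le), hl]; group
  · obtain ⟨u', rfl⟩ := MulAction.surjective q u'
    rw [length_smul] at hu'
    rw [label_conj q s (smul_eq_of_mem_term hs hu'.le),
      hl' u' hu' (fun h => h1 (by rw [h])) fun h => h2 (by rw [h])]
    simp

theorem prefix_smul_iff_of_smul_eq {g : iteratedWreathProduct H} {u w : List (Fin m)}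
    (h : g • u = u) : u <+: g • w ↔ u <+: w := by
  conv_lhs => rw [← h]
  exact smul_prefix_smul_iff g

/-- The element x is supported below S and f below T, and these regions overlap only below p. Both
elements preserve the set of words below p, so they commute elsewhere. -/
theorem commutator_smul_eq {x f : iteratedWreathProduct H} {S T : Set (List (Fin m))}
    (hx : ∀ u ∈ S, x • u = u) (hx' : ∀ w : List (Fin m), (∀ u ∈ S, ¬ u <+: w) → x • w = w)
    (hf : ∀ u ∈ T, f • u = u) (hf' : ∀ w : List (Fin m), (∀ u ∈ T, ¬ u <+: w) → f • w = w)
    {p : List (Fin m)} (hxp : x • p = p) (hfp : f • p = p)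
    (hST : ∀ u ∈ S, ∀ u' ∈ T, ∀ w, u <+: w → u' <+: w → p <+: w) {w : List (Fin m)}
    (hw : ¬ p <+: w) : (x * f * x⁻¹ * f⁻¹) • w = w := by
  simp only [mul_smul]
  by_cases h1 : ∃ u ∈ T, u <+: w
  · obtain ⟨u, hu, huw⟩ := h1
    have h2 : x • f⁻¹ • w = f⁻¹ • w := hx' _ fun u' hu' h => hw
      ((prefix_smul_iff_of_smul_eq (by rw [inv_smul_eq_iff, hfp])).1
        (hST u' hu' u hu _ h
          ((prefix_smul_iff_of_smul_eq (by rw [inv_smul_eq_iff, hf u hu])).2 huw)))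
    have h3 : x • w = w := hx' _ fun u' hu' h => hw (hST u' hu' u hu _ h huw)
    rw [← h2, inv_smul_smul, smul_inv_smul, h3]
  · push Not at h1
    have h2 : f⁻¹ • w = w := by rw [inv_smul_eq_iff, hf' w h1]
    rw [h2]
    by_cases h3 : ∃ u ∈ S, u <+: w
    · obtain ⟨u, hu, huw⟩ := h3
      have h4 : f • x⁻¹ • w = x⁻¹ • w := hf' _ fun u' hu' h => hw
        ((prefix_smul_iff_of_smul_eq (by rw [inv_smul_eq_iff, hxp])).1
          (hST u hu u' hu' _
            ((prefix_smul_iff_of_smul_eq (by rw [inv_smul_eq_iff, hx u hu])).2 huw) h))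
      rw [h4, smul_inv_smul]
    · push Not at h3
      have h4 := hx' w h3
      have h5 : x⁻¹ • w = w := by rw [inv_smul_eq_iff, h4]
      rw [h5, hf' w h1, h4]

theorem spread_mem_of_odometer {K : Subgroup (iteratedWreathProduct H)} {z : Fin m}
    {V : Set (List (Fin m))} (hV : PrefixFree V) (hK : ∀ h : H, spread V hV (odometer z h) ∈ K)
    {t : iteratedWreathProduct H} (ht : t ∈ odometerGroup H z) : spread V hV t ∈ K := by
  have : odometerGroup H z ≤ K.comap (spread V hV) := by
    refine (Subgroup.closure_le _).2 ?_
    rintro _ ⟨h, rfl⟩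
    exact hK h
  exact this ht

/-- After conjugation by the power of the odometer attached to `(v, n)`, the supports of the two
sparse generators meet only below the position of `(v, n)`, so that their commutator is supported
there. -/
theorem isolates_position {z : Fin m} {σ : H} (hσ : σ.1 z ≠ z) {A : Set (List (Fin m))}
    (hA : PrefixFree A) {K : Subgroup (iteratedWreathProduct H)} {e : ℕ}
    (hodo : ∀ h : H, spread A hA (odometer z h) ∈ K)
    (hpos : spread _ (prefixFree_positions hσ hA) (rooted σ) ∈ K)
    (hshift : ∀ h : H, spread _ (prefixFree_shiftedPositions hσ hA e) (rooted h) ∈ K)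
    {v : List (Fin m)} (hv : v ∈ A) {n : ℕ} (hn : Encodable.encode v < n) :
    Isolates K (v.length + 4 * n + 3 + e)
      (v ++ position z σ v n ++ z :: List.replicate (2 * n + e) z)
      (v ++ position z σ v n ++ σ.1 z :: List.replicate (2 * n + e) z) := by
  intro h
  set p := v ++ position z σ v n with hp
  have hpV : p ∈ positions z σ A := ⟨v, hv, n, hn, rfl⟩
  have hplen : p.length = v.length + (2 * n + 2) := by simp [hp, length_position]
  set y := spread A hA (odometer z σ ^ shift z σ v n) with hy
  have hyK : y ∈ K := by rw [hy, map_zpow]; exact K.zpow_mem (hodo σ) _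
  set u := v ++ odometer z σ ^ (-shift z σ v n) •
    (position z σ v n ++ List.replicate (2 * n + e + 1) z) with hu
  have huV : u ∈ shiftedPositions z σ A e := ⟨v, hv, n, hn, rfl⟩
  have hyu : y • u = p ++ z :: List.replicate (2 * n + e) z := by
    rw [hy, hu, spread_smul_append hA _ hv, zpow_neg, smul_inv_smul, ← List.append_assoc,
      List.replicate_succ]
  -- The label is conjugated in advance so that conjugation by y turns it into h.
  set x := y * spread _ (prefixFree_shiftedPositions hσ hA e)
    (rooted ((label y u)⁻¹ * h * label y u)) * y⁻¹ with hx
  set f := spread _ (prefixFree_positions hσ hA) (rooted σ) with hf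
  have hxK : x ∈ K := K.mul_mem (K.mul_mem hyK (hshift _)) (K.inv_mem hyK)
  have hxfix : ∀ w : List (Fin m),
      (∀ u ∈ shiftedPositions z σ A e, y • u <+: w → y • u = w) → x • w = w := by
    intro w hw
    rw [hx, mul_smul, mul_smul,
      spread_smul_of_forall (prefixFree_shiftedPositions hσ hA e) _ (w := y⁻¹ • w), smul_inv_smul]
    intro u' hu' h1
    rw [eq_inv_smul_iff]
    refine hw u' hu' ?_
    rwa [← smul_prefix_smul_iff y, smul_inv_smul] at h1
  -- The crucial separation: after conjugation by y, the two supports overlap only below p, and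
  -- there x comes from the single vertex u.
  have hcmp : ∀ u' ∈ shiftedPositions z σ A e, ∀ p' ∈ positions z σ A, ∀ w : List (Fin m),
      y • u' <+: w → p' <+: w → u' = u ∧ p' = p := by
    rintro _ ⟨v', hv', n', hn', rfl⟩ _ ⟨v'', hv'', n'', hn'', rfl⟩ w h1 h2
    rw [hy, spread_smul_append hA _ hv'] at h1
    obtain ⟨rfl, h3⟩ := hA.eq_of_prefix hv' hv'' h1 h2
    obtain ⟨⟨rfl, rfl⟩, -, rfl⟩ := shifted_separated hσ hn hn' hn'' (b := []) (by simpa using h3)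
    exact ⟨rfl, rfl⟩
  have hulen : (y • u).length = p.length + (2 * n + e + 1) := by
    rw [hyu]; simp
  have hxp : x • p = p := hxfix _ fun u' hu' h1 => by
    obtain ⟨rfl, -⟩ := hcmp u' hu' p hpV p h1 List.prefix_rfl
    have := h1.length_le
    omega
  have hfp : f • p = p := spread_smul_of_forall _ _ fun u' hu' h1 =>
    prefixFree_positions hσ hA _ hu' _ hpV h1
  have hxt : ∀ t : List (Fin m), t.length = 2 * n + e + 1 → x • (p ++ t) = p ++ t := by
    intro t ht
    refine hxfix _ fun u' hu' h1 => ?_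
    obtain ⟨rfl, -⟩ := hcmp u' hu' p hpV _ h1 (List.prefix_append _ _)
    exact h1.eq_of_length (by rw [hulen]; simp [ht])
  have hxl : label x (p ++ z :: List.replicate (2 * n + e) z) = h := by
    have h1 : spread _ (prefixFree_shiftedPositions hσ hA e)
        (rooted ((label y u)⁻¹ * h * label y u)) • u = u :=
      spread_smul_of_forall _ _ fun u' hu' h1 =>
        prefixFree_shiftedPositions hσ hA e _ hu' _ huV h1
    have h2 : label (spread _ (prefixFree_shiftedPositions hσ hA e)
        (rooted ((label y u)⁻¹ * h * label y u))) u = (label y u)⁻¹ * h * label y u :=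
      label_eq_of_forall fun a => by
        rw [h1, spread_smul_append _ _ huV, rooted_smul_cons]
    rw [← hyu, hx, label_conj _ _ h1, h2]; group
  have hxl' : ∀ t : List (Fin m), t.length = 2 * n + e + 1 →
      t ≠ z :: List.replicate (2 * n + e) z → label x (p ++ t) = 1 := by
    intro t ht htz
    refine label_eq_of_forall fun a => ?_
    rw [hxt t ht]
    refine hxfix _ fun u' hu' h1 => ?_
    rw [List.append_assoc] at h1
    obtain ⟨rfl, -⟩ := hcmp u' hu' p hpV _ h1 (List.prefix_append _ _)
    rw [hyu, List.prefix_append_right_inj] at h1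
    exact absurd ((List.prefix_of_prefix_length_le h1 (List.prefix_append t [a])
      (by simp [ht])).eq_of_length (by simp [ht])).symm htz
  have hft : ∀ (a : Fin m) (t : List (Fin m)), f • (p ++ a :: t) = p ++ σ.1 a :: t := by
    intro a t
    rw [hf, spread_smul_append _ _ hpV, rooted_smul_cons]
  have hft' : ∀ (a : Fin m) (t : List (Fin m)), f⁻¹ • (p ++ a :: t) = p ++ σ.1⁻¹ a :: t := by
    intro a t
    rw [inv_smul_eq_iff, hft]; simp
  have hfl : ∀ (a : Fin m) (t : List (Fin m)), label f (p ++ a :: t) = 1 := fun a t =>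
    label_eq_of_forall fun b => by
      rw [List.append_assoc, List.cons_append, hft, hft]; simp
  have hout : ∀ w : List (Fin m), ¬ p <+: w → (x * f * x⁻¹ * f⁻¹) • w = w := by
    intro w hw
    refine commutator_smul_eq (S := (y • ·) '' shiftedPositions z σ A e) (T := positions z σ A)
      ?_ ?_ ?_ ?_ hxp hfp ?_ hw
    · rintro _ ⟨u', hu', rfl⟩
      refine hxfix _ fun u'' hu'' h1 => ?_
      rw [prefixFree_shiftedPositions hσ hA e _ hu'' _ hu' ((smul_prefix_smul_iff y).1 h1)]
    · exact fun w hw => hxfix _ fun u' hu' h1 => absurd h1 (hw _ ⟨u', hu', rfl⟩)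
    · exact fun u' hu' => spread_smul_of_forall _ _ fun u'' hu'' h1 =>
        prefixFree_positions hσ hA _ hu'' _ hu' h1
    · exact fun w hw => spread_smul_of_forall _ _ fun u' hu' h1 => absurd h1 (hw _ hu')
    · rintro _ ⟨u', hu', rfl⟩ p' hp' w h1 h2
      exact (hcmp u' hu' p' hp' w h1 h2).2 ▸ h2
  have hin : ∀ w : List (Fin m), w.length = v.length + 4 * n + 3 + e → p <+: w →
      ∃ a t, w = p ++ a :: t ∧ t.length = 2 * n + e := by
    rintro w hw ⟨t, rfl⟩
    obtain ⟨a, t, rfl⟩ := List.exists_of_length_succ (n := 2 * n + e) t (by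
      simp only [List.length_append] at hw; omega)
    refine ⟨a, t, rfl, ?_⟩
    simp only [List.length_append, List.length_cons] at hw; omega
  have hxinv : ∀ t : List (Fin m), t.length = 2 * n + e + 1 → x⁻¹ • (p ++ t) = p ++ t :=
    fun t ht => by rw [inv_smul_eq_iff, hxt t ht]
  -- The commutator is x times the inverse of its conjugate by f. As f moves only the letter after
  -- p, this contributes a shifted copy of the inverse labels of x.
  have hlab : ∀ (a : Fin m) (t : List (Fin m)), t.length = 2 * n + e →
      label (x * f * x⁻¹ * f⁻¹) (p ++ a :: t) =
        label x (p ++ a :: t) * (label x (p ++ σ.1⁻¹ a :: t))⁻¹ := by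
    intro a t ht
    have h1 : label f⁻¹ (p ++ a :: t) = 1 := by
      have := label_inv_smul f (p ++ σ.1⁻¹ a :: t)
      rw [hft, hfl] at this
      simpa using this
    have h2 : label x⁻¹ (p ++ σ.1⁻¹ a :: t) = (label x (p ++ σ.1⁻¹ a :: t))⁻¹ := by
      have := label_inv_smul x (p ++ σ.1⁻¹ a :: t)
      rwa [hxt _ (by simp [ht])] at this
    rw [label_mul, label_mul, label_mul, hft', hxinv _ (by simp [ht]), hft, h1, h2, hfl]
    simp
  refine ⟨x * f * x⁻¹ * f⁻¹, K.mul_mem (K.mul_mem (K.mul_mem hxK hpos) (K.inv_mem hxK))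
    (K.inv_mem hpos), mem_term.2 fun w hw => ?_, ?_, fun w hw h1 h2 => ?_⟩
  · by_cases hpw : p <+: w
    · obtain ⟨a, t, rfl, ht⟩ := hin w hw hpw
      rw [mul_smul, mul_smul, mul_smul, hft', hxinv _ (by simp [ht]), hft]
      simpa using hxt (a :: t) (by simp [ht])
    · exact hout w hpw
  · rw [hlab _ _ (by simp), hxl, hxl' _ (by simp) fun h1 => ?_, inv_one, mul_one]
    rw [List.cons.injEq, Equiv.Perm.inv_eq_iff_eq] at h1
    exact hσ h1.1.symm
  · by_cases hpw : p <+: w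
    · obtain ⟨a, t, rfl, ht⟩ := hin w hw hpw
      rw [hlab _ _ ht, hxl' _ (by simp [ht]) fun h3 => h1 (by rw [h3]),
        hxl' _ (by simp [ht]) fun h3 => h2 ?_, inv_one, mul_one]
      rw [List.cons.injEq, Equiv.Perm.inv_eq_iff_eq] at h3
      rw [h3.1, h3.2]
    · refine label_eq_of_forall fun a => ?_
      rw [hout w hpw, hout]
      · rfl
      · intro h3
        rcases List.prefix_concat_iff.1 h3 with h4 | h4
        · have := congrArg List.length h4
          simp only [List.length_append, List.length_singleton] at this
          omega
        · exact hpw h4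

/-- The partner does not depend on y. The odometers at child positions move the tail below p ++ [z]
while fixing the partner, which lies below p ++ [σ.1 z]. A further conjugation, chosen from c alone,
carries p ++ [z] to v ++ c. -/
theorem exists_isolates (hH : MulAction.IsPretransitive H (Fin m)) {z : Fin m} {σ : H}
    (hσ : σ.1 z ≠ z) {A : Set (List (Fin m))}
    (hA : PrefixFree A) {K : Subgroup (iteratedWreathProduct H)} {e : ℕ}
    (hodo : ∀ h : H, spread A hA (odometer z h) ∈ K)
    (hchild : ∀ h : H, spread _ (prefixFree_childPositions hσ hA) (odometer z h) ∈ K)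
    (hpos : spread _ (prefixFree_positions hσ hA) (rooted σ) ∈ K)
    (hshift : ∀ h : H, spread _ (prefixFree_shiftedPositions hσ hA e) (rooted h) ∈ K)
    {v : List (Fin m)} (hv : v ∈ A) {n : ℕ} (hn : Encodable.encode v < n)
    (c : List (Fin m)) (hc : c.length = 2 * n + 3) :
    ∃ w, ∀ y : List (Fin m), y.length = 2 * n + e →
      Isolates K (v.length + 4 * n + 3 + e) (v ++ c ++ y) w := by
  obtain ⟨t, ht, htc⟩ := odometerGroup_exists_smul_eq hH z (v := position z σ v n ++ [z])
    (w := c) (by simp [hc, length_position])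
  refine ⟨spread A hA t • (v ++ position z σ v n ++ σ.1 z :: List.replicate (2 * n + e) z),
    fun y hy => ?_⟩
  -- The tail is first moved to the preimage of y under t, because t acts on it as well.
  obtain ⟨y', hy', hty⟩ := smul_append_eq t⁻¹ c y
  obtain ⟨s, hs, hsy⟩ := odometerGroup_exists_smul_eq hH z
    (v := List.replicate (2 * n + e) z) (w := y') (by simp [hy', hy])
  have hmem : v ++ (position z σ v n ++ [z]) ∈ childPositions z σ A := ⟨v, hv, n, hn, rfl⟩
  have h1 := (isolates_position hσ hA hodo hpos hshift hv hn).smul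
    (by simp [length_position]; omega) (spread_mem_of_odometer _ hchild hs)
  rw [show v ++ position z σ v n ++ z :: List.replicate (2 * n + e) z =
    (v ++ (position z σ v n ++ [z])) ++ List.replicate (2 * n + e) z by simp,
    spread_smul_append _ _ hmem, hsy, spread_smul_of_forall] at h1
  · have h2 := h1.smul (by simp [length_position, hy', hy]; omega)
      (spread_mem_of_odometer _ hodo ht)
    convert h2 using 1
    rw [List.append_assoc, List.append_assoc v, spread_smul_append _ _ hv, ← htc]
    congr 1
    rw [htc, ← inv_smul_eq_iff, hty, ← htc, inv_smul_smul]
  · rintro _ ⟨v', hv', n', hn', rfl⟩ h2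
    rw [List.append_assoc] at h2
    obtain ⟨rfl, h3⟩ := hA.eq_of_prefix hv' hv h2 List.prefix_rfl
    obtain ⟨-, rfl⟩ := position_eq_of_prefix hσ hn' hn (prefix_or_prefix_of_append h3)
    rw [List.prefix_append_right_inj, List.prefix_append_right_inj] at h2
    exact absurd (List.cons_prefix_cons.1 h2).1.symm hσ

/-! ### Regions of prescribed density -/

/-- The words of length `n` in `U`. -/
def atLevel (U : Set (List (Fin m))) (n : ℕ) : Set (List (Fin m)) := {w | w.length = n ∧ w ∈ U}

theorem finite_atLevel (U : Set (List (Fin m))) (n : ℕ) : (atLevel U n).Finite :=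
  (List.finite_length_eq (Fin m) n).subset fun _ h => h.1

theorem ncard_length_eq (m n : ℕ) : {w : List (Fin m) | w.length = n}.ncard = m ^ n := by
  have : Nat.card (List.Vector (Fin m) n) = m ^ n := by
    rw [Nat.card_eq_fintype_card, card_vector, Fintype.card_fin]
  exact this

theorem ncard_below (U : Set (List (Fin m))) (n : ℕ) :
    (below U n).ncard = ∑ k ∈ Finset.range n, (atLevel U k).ncard := by
  induction n with
  | zero => simp [below]
  | succ n ih =>
    rw [Finset.sum_range_succ, ← ih, ← Set.ncard_union_eq _ (finite_below U n) (finite_atLevel U n)]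
    · congr 1
      ext w
      simp only [below, atLevel, Set.mem_ofPred_eq, Set.mem_union, Nat.lt_succ_iff_lt_or_eq]
      tauto
    · exact Set.disjoint_left.2 fun w h h' => h.1.ne h'.1

theorem ncard_below_univ (m n : ℕ) :
    (below (Set.univ : Set (List (Fin m))) n).ncard = ∑ k ∈ Finset.range n, m ^ k := by
  rw [ncard_below]
  refine Finset.sum_congr rfl fun k _ => ?_
  rw [← ncard_length_eq m k]
  simp [atLevel]

/-- The number with given base-`m` digits, most significant digit first. -/
def wordValue (w : List (Fin m)) : ℕ := w.foldl (fun a x => a * m + x) 0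

theorem wordValue_concat (w : List (Fin m)) (x : Fin m) :
    wordValue (w ++ [x]) = wordValue w * m + x := by
  simp [wordValue]

theorem wordValue_lt (w : List (Fin m)) : wordValue w < m ^ w.length := by
  induction w using List.reverseRecOn with
  | nil => simp [wordValue]
  | append_singleton w x ih =>
    rw [wordValue_concat, List.length_append, List.length_singleton, pow_succ]
    have := x.2
    calc wordValue w * m + x < wordValue w * m + m := by omega
      _ = (wordValue w + 1) * m := by ring
      _ ≤ m ^ w.length * m := Nat.mul_le_mul_right _ ih

theorem eq_of_wordValue_eq {w w' : List (Fin m)} (hl : w.length = w'.length)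
    (h : wordValue w = wordValue w') : w = w' := by
  induction w using List.reverseRecOn generalizing w' with
  | nil => exact (List.length_eq_zero_iff.1 hl.symm).symm
  | append_singleton w x ih =>
    rcases List.eq_nil_or_concat w' with rfl | ⟨w', y, rfl⟩
    · simp at hl
    · rw [List.concat_eq_append] at *
      rw [wordValue_concat, wordValue_concat] at h
      have hm : 0 < m := x.pos
      have h1 : wordValue w = wordValue w' := by
        have := congrArg (· / m) h
        simpa [Nat.mul_comm _ m, Nat.mul_add_div hm, Nat.div_eq_of_lt x.2,
          Nat.div_eq_of_lt y.2] using this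
      rw [h1] at h
      rw [ih (by simpa using hl) h1, Fin.ext (Nat.add_left_cancel h)]

theorem ncard_wordValue_lt {n a : ℕ} (ha : a ≤ m ^ n) :
    {w : List (Fin m) | w.length = n ∧ wordValue w < a}.ncard = a := by
  have hinj : Set.InjOn wordValue {w : List (Fin m) | w.length = n} := fun w hw w' hw' h =>
    eq_of_wordValue_eq (hw.trans hw'.symm) h
  have himg : wordValue '' {w : List (Fin m) | w.length = n} = Set.Iio (m ^ n) := by
    refine Set.eq_of_subset_of_ncard_le ?_ ?_ (Set.finite_Iio _)
    · rintro _ ⟨w, hw, rfl⟩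
      exact (show w.length = n from hw) ▸ wordValue_lt w
    · rw [hinj.ncard_image, ncard_length_eq, ← Finset.coe_Iio,
        Set.ncard_coe_finset, Nat.card_Iio]
  rw [← (hinj.mono fun w hw => hw.1 : Set.InjOn wordValue
    {w : List (Fin m) | w.length = n ∧ wordValue w < a}).ncard_image]
  rw [show wordValue '' {w : List (Fin m) | w.length = n ∧ wordValue w < a} = Set.Iio a from ?_,
    ← Finset.coe_Iio, Set.ncard_coe_finset, Nat.card_Iio]
  ext k
  constructor
  · rintro ⟨w, hw, rfl⟩
    exact hw.2
  · intro hk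
    obtain ⟨w, hw, rfl⟩ := himg.ge (show k ∈ Set.Iio (m ^ n) from lt_of_lt_of_le hk ha)
    exact ⟨w, ⟨hw, hk⟩, rfl⟩

/-- On each level take the first ⌈a * m ^ n⌉ - 1 words in lexicographic order, with truncated
subtraction. Membership means wordValue w + 1 < a * m ^ n; since m * (wordValue w + 1) bounds the
value plus one of every child, it passes to children. Subtracting 1 also keeps the count at most a *
m ^ n, with no error term in the upper bound. -/
theorem exists_region (hm : 0 < m) (a : ℝ) (h0 : 0 ≤ a) (h1 : a ≤ 1) :
    ∃ U : Set (List (Fin m)), (∀ w ∈ U, ∀ x, w ++ [x] ∈ U) ∧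
      ∀ n, ((atLevel U n).ncard : ℝ) ≤ a * m ^ n ∧ a * m ^ n ≤ (atLevel U n).ncard + 1 := by
  have hpos : ∀ n, (0 : ℝ) ≤ a * m ^ n := fun n => by positivity
  have hcard : ∀ n, (atLevel {w : List (Fin m) | wordValue w < ⌈a * m ^ w.length⌉₊ - 1} n).ncard =
      ⌈a * m ^ n⌉₊ - 1 := by
    intro n
    have hle : ⌈a * (m : ℝ) ^ n⌉₊ - 1 ≤ m ^ n := by
      refine (Nat.sub_le _ _).trans (Nat.ceil_le.2 ?_)
      push_cast
      exact mul_le_of_le_one_left (by positivity) h1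
    rw [← ncard_wordValue_lt hle]
    congr 1
    ext w
    simp only [atLevel, Set.mem_ofPred_eq]
    exact and_congr_right fun h => by rw [h]
  refine ⟨{w | wordValue w < ⌈a * m ^ w.length⌉₊ - 1}, fun w hw x => ?_, fun n => ?_⟩
  · rw [Set.mem_ofPred_eq] at hw ⊢
    rw [wordValue_concat, List.length_append, List.length_singleton, Nat.lt_sub_iff_add_lt,
      Nat.lt_ceil]
    rw [Nat.lt_sub_iff_add_lt, Nat.lt_ceil] at hw
    have hx : (x : ℝ) + 1 ≤ m := by exact_mod_cast x.2
    have hm' : (0 : ℝ) < m := by exact_mod_cast hm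
    push_cast at hw ⊢
    rw [pow_succ, ← mul_assoc]
    calc (wordValue w : ℝ) * m + x + 1 ≤ (wordValue w + 1) * m := by linarith
      _ < a * m ^ w.length * m := mul_lt_mul_of_pos_right hw hm'
  · rw [hcard]
    constructor
    · rcases Nat.eq_zero_or_pos ⌈a * (m : ℝ) ^ n⌉₊ with h | h
      · simpa [h] using hpos n
      · rw [Nat.cast_sub h]
        have := Nat.ceil_lt_add_one (hpos n)
        push_cast; linarith
    · have := Nat.le_ceil (a * (m : ℝ) ^ n)
      have h2 : (⌈a * (m : ℝ) ^ n⌉₊ : ℝ) ≤ ((⌈a * (m : ℝ) ^ n⌉₊ - 1 : ℕ) : ℝ) + 1 := by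
        exact_mod_cast (by omega : ⌈a * (m : ℝ) ^ n⌉₊ ≤ ⌈a * (m : ℝ) ^ n⌉₊ - 1 + 1)
      linarith

/-- The minimal vertices of a region. -/
def minimalWords (U : Set (List (Fin m))) : Set (List (Fin m)) :=
  {w | w ∈ U ∧ ∀ u ∈ U, u <+: w → u = w}

theorem prefixFree_minimalWords (U : Set (List (Fin m))) : PrefixFree (minimalWords U) :=
  fun _ hu _ hv h => hv.2 _ hu.1 h

theorem exists_minimalWords_prefix {U : Set (List (Fin m))} (n : ℕ) {w : List (Fin m)}
    (hw : w ∈ U) (hn : w.length = n) : ∃ v ∈ minimalWords U, v <+: w := by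
  induction n using Nat.strong_induction_on generalizing w with
  | _ n ih =>
    by_cases h : ∀ u ∈ U, u <+: w → u = w
    · exact ⟨w, ⟨hw, h⟩, List.prefix_rfl⟩
    · push Not at h
      obtain ⟨u, hu, huw, hne⟩ := h
      obtain ⟨v, hv, hvu⟩ := ih u.length
        (hn ▸ lt_of_le_of_ne huw.length_le fun h => hne (huw.eq_of_length h)) hu rfl
      exact ⟨v, hv, hvu.trans huw⟩

theorem mem_of_prefix {U : Set (List (Fin m))} (hU : ∀ w ∈ U, ∀ x, w ++ [x] ∈ U)
    {v w : List (Fin m)} (hv : v ∈ U) (h : v <+: w) : w ∈ U := by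
  obtain ⟨t, rfl⟩ := h
  induction t using List.reverseRecOn with
  | nil => simpa using hv
  | append_singleton t x ih =>
    rw [← List.append_assoc]
    exact hU _ ih x

theorem ncard_take_mem (U : Set (List (Fin m))) {k n : ℕ} (hkn : k ≤ n) :
    {w : List (Fin m) | w.length = n ∧ w.take k ∈ U}.ncard =
      (atLevel U k).ncard * m ^ (n - k) := by
  rw [← ncard_length_eq m (n - k), ← Set.ncard_prod]
  refine (Set.ncard_congr (fun p _ => p.1 ++ p.2) ?_ ?_ ?_).symm
  · rintro ⟨a, b⟩ ⟨⟨ha, haU⟩, hb⟩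
    refine ⟨?_, ?_⟩
    · simp only [Set.mem_ofPred_eq] at hb ha
      simp only [List.length_append, ha, hb]; omega
    · simp only at ha haU
      rwa [List.take_append_of_le_length ha.ge, List.take_of_length_le ha.le]
  · rintro ⟨a, b⟩ ⟨a', b'⟩ ⟨⟨ha, _⟩, _⟩ ⟨⟨ha', _⟩, _⟩ h
    obtain ⟨h1, h2⟩ := List.append_inj h (ha.trans ha'.symm)
    exact Prod.ext h1 h2
  · rintro w ⟨hw, hwU⟩
    refine ⟨(w.take k, w.drop k), ⟨⟨?_, hwU⟩, ?_⟩, List.take_append_drop k w⟩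
    · simp [hw, hkn]
    · simp [hw]

end IteratedWreath

/-! ### Finitely generated subgroups of prescribed dimension -/

namespace GroupFiltration

variable {G : Type*} [Group G] (F : GroupFiltration G)

theorem exists_inv_mul_mem_of_mem_closure {S : Set G} {g : G} (h : g ∈ @closure G F.topology S)
    (n : ℕ) : ∃ s ∈ S, g⁻¹ * s ∈ F.term n := by
  let := F.topology
  obtain ⟨s, hs, hsS⟩ := mem_closure_iff_nhds.1 h {x | g⁻¹ * x ∈ F.term n}
    (F.mem_nhds_topology.2 ⟨n, fun k hk => by simpa using hk⟩)
  exact ⟨s, hsS, hs⟩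

/-- The closure of a subgroup in the topology of the filtration. -/
def closedSubgroup (K : Subgroup G) : Subgroup G :=
  @Subgroup.topologicalClosure G F.topology _ F.isTopologicalGroup K

theorem isClosedSubgroup_closedSubgroup (K : Subgroup G) :
    F.IsClosedSubgroup (F.closedSubgroup K) :=
  @isClosed_closure G F.topology _

theorem le_closedSubgroup (K : Subgroup G) : K ≤ F.closedSubgroup K :=
  @Subgroup.le_topologicalClosure G F.topology _ F.isTopologicalGroup K

end GroupFiltration

namespace IteratedWreath

variable {m : ℕ} {H : Subgroup (Equiv.Perm (Fin m))}

open Filter in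
theorem tendsto_index (hm : 0 < m) (hH : 2 ≤ Nat.card H) :
    Tendsto (fun n => ((TreeAut.levelFiltration (iteratedWreathProduct H)).term n).index)
      atTop atTop := by
  refine tendsto_atTop_mono (fun n => ?_) tendsto_id
  rw [index_term, ncard_below_univ]
  have h1 : n ≤ ∑ k ∈ Finset.range n, m ^ k := by
    calc n = ∑ k ∈ Finset.range n, 1 := by simp
      _ ≤ _ := Finset.sum_le_sum fun k _ => Nat.one_le_pow _ _ hm
  exact h1.trans (Nat.lt_pow_self hH).le

/-- The parameters of the generators. -/
abbrev GeneratorIndex (H : Subgroup (Equiv.Perm (Fin m))) : Type :=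
  H ⊕ H ⊕ Unit ⊕ (H × Fin 4)

/-- The generators of a subgroup supported below the vertices of `A`. -/
noncomputable def generator {z : Fin m} {σ : H} (hσ : σ.1 z ≠ z) {A : Set (List (Fin m))}
    (hA : PrefixFree A) : GeneratorIndex H → iteratedWreathProduct H
  | .inl h => spread A hA (odometer z h)
  | .inr (.inl h) => spread _ (prefixFree_childPositions hσ hA) (odometer z h)
  | .inr (.inr (.inl _)) => spread _ (prefixFree_positions hσ hA) (rooted σ)
  | .inr (.inr (.inr (h, e))) => spread _ (prefixFree_shiftedPositions hσ hA e) (rooted h)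

theorem generator_smul_eq {z : Fin m} {σ : H} (hσ : σ.1 z ≠ z) {A : Set (List (Fin m))}
    (hA : PrefixFree A) (i : GeneratorIndex H) {w : List (Fin m)}
    (hw : ∀ v ∈ A, v <+: w → v = w) : generator hσ hA i • w = w := by
  have key : ∀ (V : Set (List (Fin m))) (hV : PrefixFree V) (g : iteratedWreathProduct H),
      (∀ u ∈ V, ∃ v ∈ A, v <+: u) → spread V hV g • w = w := by
    refine fun V hV g h => spread_smul_of_forall hV g fun u hu huw => ?_
    obtain ⟨v, hv, hvu⟩ := h u hu
    have := hw v hv (hvu.trans huw)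
    subst this
    exact huw.eq_of_length (le_antisymm huw.length_le hvu.length_le)
  rcases i with h | h | h | ⟨h, e⟩
  · exact key _ _ _ fun u hu => ⟨u, hu, List.prefix_rfl⟩
  all_goals
    refine key _ _ _ ?_
    rintro _ ⟨v, hv, n, hn, rfl⟩
    exact ⟨v, hv, List.prefix_append _ _⟩

/-- Fixing a given word is a closed condition, so it passes from the generators to the closure.
Neither w nor its children have a proper prefix in U, hence all of them are fixed. -/
theorem label_eq_one_of_notMem {z : Fin m} {σ : H} (hσ : σ.1 z ≠ z) {U : Set (List (Fin m))}
    (hU : ∀ w ∈ U, ∀ x, w ++ [x] ∈ U) {g : iteratedWreathProduct H}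
    (hg : g ∈ (TreeAut.levelFiltration (iteratedWreathProduct H)).closedSubgroup
      (Subgroup.closure (Set.range (generator hσ (prefixFree_minimalWords U)))))
    {w : List (Fin m)} (hw : w ∉ U) : label g w = 1 := by
  have key : ∀ w : List (Fin m), (∀ v ∈ minimalWords U, v <+: w → v = w) → g • w = w := by
    intro w hw
    obtain ⟨s, hs, hgs⟩ :=
      GroupFiltration.exists_inv_mul_mem_of_mem_closure _ hg w.length
    have h1 : Subgroup.closure (Set.range (generator hσ (prefixFree_minimalWords U))) ≤
        MulAction.stabilizer _ w := by
      refine (Subgroup.closure_le _).2 ?_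
      rintro _ ⟨i, rfl⟩
      exact generator_smul_eq hσ _ i hw
    have h2 : s • w = w := h1 hs
    have h3 := mem_term.1 hgs w rfl
    rw [mul_smul, h2, inv_smul_eq_iff] at h3
    exact h3.symm
  refine label_eq_of_forall fun x => ?_
  rw [key w fun v hv hvw => absurd (mem_of_prefix hU hv.1 hvw) hw, key]
  · rfl
  · intro v hv hvw
    rcases List.prefix_concat_iff.1 hvw with h | h
    · simpa using h
    · exact absurd (mem_of_prefix hU hv.1 h) hw

/-- Only minimal vertices of length at most k matter for words with a prefix of length k in U. There
are finitely many of them, so one N₀ serves all. The isolated vertices of level N interfere only at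
their partners, which are removed. -/
theorem exists_isolated_level (hH : MulAction.IsPretransitive H (Fin m)) {z : Fin m} {σ : H}
    (hσ : σ.1 z ≠ z) (U : Set (List (Fin m))) {K : Subgroup (iteratedWreathProduct H)}
    (hK : ∀ i, generator hσ (prefixFree_minimalWords U) i ∈ K) (k : ℕ) :
    ∃ C N₀ : ℕ, ∀ N ≥ N₀, ∃ S ⊆ {w : List (Fin m) | w.length = N},
      (∀ u ∈ S, ∀ h : H, ∃ s ∈ K,
        s ∈ (TreeAut.levelFiltration (iteratedWreathProduct H)).term N ∧ label s u = h ∧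
          ∀ w ∈ S, w ≠ u → label s w = 1) ∧
      (atLevel U k).ncard * m ^ (N - k) ≤ S.ncard + C * m ^ (N / 2) := by
  set A := {v | v ∈ minimalWords U ∧ v.length < k + 1} with hAdef
  have hAfin : A.Finite := (List.finite_length_lt (Fin m) (k + 1)).subset fun _ h => h.2
  obtain ⟨B, hB⟩ : ∃ B, ∀ v ∈ A, Encodable.encode v ≤ B :=
    (hAfin.image Encodable.encode).bddAbove.imp fun B hB v hv => hB ⟨v, hv, rfl⟩
  -- The bound on N forces n > B in the division below and leaves room for a prefix c of length at
  -- most N / 2 + 3. The factor m ^ 3 comes from the three extra letters of c.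
  refine ⟨A.ncard * m ^ 3, 2 * k + 4 * (B + 1) + 3, fun N hN => ?_⟩
  have hpart : ∀ v ∈ A, ∃ n ≤ N / 2, ∀ c : List (Fin m), c.length = n + 3 →
      ∃ w, ∀ y : List (Fin m), (v ++ c ++ y).length = N → Isolates K N (v ++ c ++ y) w := by
    intro v hv
    have hvB := hB v hv
    have hvk : v.length < k + 1 := hv.2
    -- Isolation happens on levels v.length + 4 * n + 3 + e, so the four values of e in the
    -- generators reach every large level.
    set n := (N - v.length - 3) / 4 with hn
    set e := (N - v.length - 3) % 4 with he
    have hNe : N = v.length + 4 * n + 3 + e := by omega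
    have he4 : e < 4 := Nat.mod_lt _ (by norm_num)
    refine ⟨2 * n, by omega, fun c hc => ?_⟩
    obtain ⟨w, hw⟩ := exists_isolates hH hσ (prefixFree_minimalWords U) (K := K) (e := e)
      (fun h => hK (.inl h)) (fun h => hK (.inr (.inl h))) (hK (.inr (.inr (.inl ()))))
      (fun h => hK (.inr (.inr (.inr (h, ⟨e, he4⟩))))) hv.1 (n := n) (by omega) c hc
    refine ⟨w, fun y hy => ?_⟩
    rw [hNe]
    refine hw y ?_
    simp only [List.length_append, hc] at hy
    omega
  choose! n hn partner hpartner using hpart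
  set D := (fun p : List (Fin m) × List (Fin m) => partner p.1 (p.2.take (n p.1 + 3))) ''
    (A ×ˢ {c : List (Fin m) | c.length = N / 2 + 3}) with hD
  have hprodfin : (A ×ˢ {c : List (Fin m) | c.length = N / 2 + 3}).Finite :=
    hAfin.prod (List.finite_length_eq (Fin m) _)
  have hDcard : D.ncard ≤ A.ncard * m ^ 3 * m ^ (N / 2) := by
    refine (Set.ncard_image_le hprodfin).trans ?_
    rw [Set.ncard_prod, ncard_length_eq, pow_add]
    exact le_of_eq (by ring)
  refine ⟨{w | w.length = N ∧ w.take k ∈ U} \ D, fun w hw => hw.1.1, ?_, ?_⟩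
  · rintro u ⟨⟨hu, huU⟩, -⟩ h
    obtain ⟨v, hv, hvu⟩ := exists_minimalWords_prefix _ huU rfl
    have hvA : v ∈ A := ⟨hv, by
      have := hvu.length_le
      rw [List.length_take] at this
      omega⟩
    obtain ⟨y, rfl⟩ := hvu.trans (List.take_prefix k u)
    have hnv := hn v hvA
    have hvk : v.length < k + 1 := hvA.2
    rw [List.length_append] at hu
    have hc : (y.take (n v + 3)).length = n v + 3 := by
      rw [List.length_take]; omega
    have hiso := hpartner v hvA _ hc (y.drop (n v + 3)) (by
      rw [List.append_assoc, List.take_append_drop]; simpa using hu)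
    rw [List.append_assoc, List.take_append_drop] at hiso
    obtain ⟨s, hsK, hs, hl, hl'⟩ := hiso h
    refine ⟨s, hsK, hs, hl, fun w hw hwu => hl' w hw.1.1 hwu fun hw' => hw.2 ?_⟩
    -- Padding with z gives all prefixes the common length N / 2 + 3 used to count the partners.
    refine ⟨(v, y.take (n v + 3) ++ List.replicate (N / 2 - n v) z), ⟨hvA, ?_⟩, ?_⟩
    · simp only [Set.mem_ofPred_eq, List.length_append, hc, List.length_replicate]
      omega
    · simp only
      rw [hw', List.take_append_of_le_length hc.ge, List.take_of_length_le hc.le]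
  · rw [← ncard_take_mem U (show k ≤ N by omega)]
    exact (Set.ncard_le_ncard_sdiff_add_ncard _ _ (hprodfin.image _)).trans
      (Nat.add_le_add_left hDcard _)

theorem exists_isolated_set (hm : 2 ≤ m) (hH : MulAction.IsPretransitive H (Fin m)) {z : Fin m}
    {σ : H} (hσ : σ.1 z ≠ z) (U : Set (List (Fin m))) {K : Subgroup (iteratedWreathProduct H)}
    (hK : ∀ i, generator hσ (prefixFree_minimalWords U) i ∈ K) {a b : ℝ} (hab : b < a)
    (hU : ∀ n, a * m ^ n ≤ (atLevel U n).ncard + 1) :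
    ∃ S : Set (List (Fin m)),
      (∀ u ∈ S, ∀ h : H, ∃ s ∈ K,
        s ∈ (TreeAut.levelFiltration (iteratedWreathProduct H)).term u.length ∧ label s u = h ∧
          ∀ w ∈ S, w.length = u.length → w ≠ u → label s w = 1) ∧
      ∃ N₁, ∀ N ≥ N₁, b * m ^ N ≤ (atLevel S N).ncard := by
  have hm1 : (1 : ℝ) < m := by exact_mod_cast hm
  have hm0 : (0 : ℝ) < m := by linarith
  -- The gap a - b is spent in two halves: k absorbs the rounding error of U on level k, and j
  -- absorbs the removed partners once N ≥ 2 * j.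
  obtain ⟨k, hk⟩ := pow_unbounded_of_one_lt (2 / (a - b)) hm1
  obtain ⟨C, N₀, hC⟩ := exists_isolated_level hH hσ U hK k
  choose! S hSN hS hcard using hC
  obtain ⟨j, hj⟩ := pow_unbounded_of_one_lt (2 * C / (a - b)) hm1
  refine ⟨{w | N₀ ≤ w.length ∧ w ∈ S w.length}, fun u hu h => ?_,
    N₀ + k + 2 * j, fun N hN => ?_⟩
  · obtain ⟨s, hsK, hs, hl, hl'⟩ := hS _ hu.1 u hu.2 h
    exact ⟨s, hsK, hs, hl, fun w hw hwu => hl' w (hwu ▸ hw.2)⟩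
  · have hlev : atLevel {w | N₀ ≤ w.length ∧ w ∈ S w.length} N = S N := by
      ext w
      constructor
      · rintro ⟨rfl, -, h⟩
        exact h
      · intro h
        have hw : w.length = N := hSN N (by omega) h
        exact ⟨hw, by omega, by rwa [hw]⟩
    rw [hlev]
    have h1 : ((atLevel U k).ncard : ℝ) * m ^ (N - k) ≤ (S N).ncard + C * m ^ (N / 2) := by
      exact_mod_cast hcard N (by omega)
    have hd : 0 < a - b := sub_pos.2 hab
    rw [div_lt_iff₀ hd] at hk hj
    have hNk : (m : ℝ) ^ N = m ^ k * m ^ (N - k) := by rw [← pow_add]; congr 1; omega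
    have h2 : a * m ^ N ≤ (atLevel U k).ncard * m ^ (N - k) + m ^ (N - k) := by
      calc a * (m : ℝ) ^ N = (a * m ^ k) * m ^ (N - k) := by rw [hNk]; ring
        _ ≤ ((atLevel U k).ncard + 1) * m ^ (N - k) :=
          mul_le_mul_of_nonneg_right (hU k) (by positivity)
        _ = _ := by ring
    have h3 : 2 * (m : ℝ) ^ (N - k) ≤ (a - b) * m ^ N := by
      rw [hNk]
      calc 2 * (m : ℝ) ^ (N - k) ≤ (m ^ k * (a - b)) * m ^ (N - k) :=
            mul_le_mul_of_nonneg_right hk.le (by positivity)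
        _ = _ := by ring
    have h4 : 2 * (C * (m : ℝ) ^ (N / 2)) ≤ (a - b) * m ^ N := by
      calc 2 * (C * (m : ℝ) ^ (N / 2)) = 2 * C * m ^ (N / 2) := by ring
        _ ≤ (m ^ j * (a - b)) * m ^ (N / 2) :=
            mul_le_mul_of_nonneg_right hj.le (by positivity)
        _ = (a - b) * m ^ (j + N / 2) := by ring
        _ ≤ (a - b) * m ^ N := mul_le_mul_of_nonneg_left
            (pow_le_pow_right₀ hm1.le (by omega)) hd.le
    linarith

theorem hdim_le_one (hm : 0 < m) (hH : 2 ≤ Nat.card H)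
    (K : Subgroup (iteratedWreathProduct H)) :
    (TreeAut.levelFiltration (iteratedWreathProduct H)).hdim K ≤ 1 := by
  refine GroupFiltration.hdim_le _ (tendsto_index hm hH) K 1 fun n => ?_
  have := (TreeAut.levelFiltration (iteratedWreathProduct H)).finiteIndex n
  have := (TreeAut.levelFiltration (iteratedWreathProduct H)).normal n
  simpa using Nat.le_of_dvd (Nat.pos_of_ne_zero Subgroup.FiniteIndex.index_ne_zero)
    (Subgroup.relIndex_dvd_index_of_normal _ K)

theorem hdim_closedSubgroup (hm : 2 ≤ m) (hH : MulAction.IsPretransitive H (Fin m))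
    (hq : 2 ≤ Nat.card H) {z : Fin m} {σ : H} (hσ : σ.1 z ≠ z) {U : Set (List (Fin m))}
    (hU : ∀ w ∈ U, ∀ x, w ++ [x] ∈ U) (a : NNReal) (ha : a ≤ 1)
    (hle : ∀ n, ((atLevel U n).ncard : ℝ) ≤ a * m ^ n)
    (hge : ∀ n, a * (m : ℝ) ^ n ≤ (atLevel U n).ncard + 1) :
    (TreeAut.levelFiltration (iteratedWreathProduct H)).hdim
      ((TreeAut.levelFiltration (iteratedWreathProduct H)).closedSubgroup
        (Subgroup.closure (Set.range (generator hσ (prefixFree_minimalWords U))))) = a := by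
  set K := (TreeAut.levelFiltration (iteratedWreathProduct H)).closedSubgroup
    (Subgroup.closure (Set.range (generator hσ (prefixFree_minimalWords U)))) with hK
  have htend := tendsto_index (H := H) (show 0 < m by omega) hq
  have hq1 : (1 : ℝ≥0∞) ≤ Nat.card H := by exact_mod_cast (show 1 ≤ Nat.card H by omega)
  have hpow : ∀ k : ℕ, ((Nat.card H ^ k : ℕ) : ℝ≥0∞) = (Nat.card H : ℝ≥0∞) ^ (k : ℝ) := by
    intro k; rw [ENNReal.rpow_natCast]; push_cast; rfl
  refine le_antisymm (GroupFiltration.hdim_le _ htend K a fun n => ?_)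
    (ENNReal.le_of_forall_nnreal_lt fun b hb => ?_)
  · have h1 := relIndex_le K U (fun g hg w hw => label_eq_one_of_notMem hσ hU hg hw) n
    refine (Nat.cast_le.2 h1).trans ?_
    rw [index_term, hpow, hpow, ← ENNReal.rpow_mul]
    refine ENNReal.rpow_le_rpow_of_exponent_le hq1 ?_
    rw [ncard_below_univ, ncard_below, mul_comm]
    push_cast
    rw [Finset.mul_sum]
    exact Finset.sum_le_sum fun k _ => hle k
  · rcases eq_or_ne b 0 with rfl | hb0
    · simp
    have hgen : ∀ i, generator hσ (prefixFree_minimalWords U) i ∈ K := fun i =>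
      GroupFiltration.le_closedSubgroup _ _ (Subgroup.subset_closure ⟨i, rfl⟩)
    have hba : b < a := ENNReal.coe_lt_coe.1 hb
    obtain ⟨S, hS, N₁, hN₁⟩ := exists_isolated_set hm hH hσ U hgen
      (NNReal.coe_lt_coe.2 hba) hge
    refine GroupFiltration.le_hdim _ htend compactSpace K
      (GroupFiltration.isClosedSubgroup_closedSubgroup _ _) b
      -- This constant pays for the levels below N₁, where nothing is known about S.
      ((Nat.card H : NNReal) ^ ∑ k ∈ Finset.range N₁, m ^ k) (pos_iff_ne_zero.2 hb0)
      (pow_pos (by exact_mod_cast (show 0 < Nat.card H by omega)) _) fun n => ?_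
    have h1 := le_relIndex K S hS n
    refine le_trans ?_ (mul_le_mul_right (Nat.cast_le.2 h1) _)
    have hC : (((Nat.card H : NNReal) ^ ∑ k ∈ Finset.range N₁, m ^ k : NNReal) : ℝ≥0∞) =
        ((Nat.card H ^ ∑ k ∈ Finset.range N₁, m ^ k : ℕ) : ℝ≥0∞) := by push_cast; rfl
    rw [index_term, hC, ← Nat.cast_mul, ← pow_add, hpow, hpow, ← ENNReal.rpow_mul]
    refine ENNReal.rpow_le_rpow_of_exponent_le hq1 ?_
    rw [ncard_below_univ, ncard_below, mul_comm]
    push_cast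
    have hterm : ∀ k, (b : ℝ) * m ^ k ≤
        (if k < N₁ then (m : ℝ) ^ k else 0) + (atLevel S k).ncard := by
      intro k
      split_ifs with hk
      · have : (b : ℝ) ≤ 1 := NNReal.coe_le_coe.2 (hba.le.trans ha)
        have h2 : (b : ℝ) * m ^ k ≤ m ^ k := mul_le_of_le_one_left (by positivity) this
        have h3 : (0 : ℝ) ≤ (atLevel S k).ncard := Nat.cast_nonneg _
        linarith
      · simpa using hN₁ k (by omega)
    rw [Finset.mul_sum]
    refine (Finset.sum_le_sum fun k _ => hterm k).trans ?_
    rw [Finset.sum_add_distrib]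
    refine add_le_add_left ?_ _
    rw [← Finset.sum_filter]
    refine Finset.sum_le_sum_of_subset_of_nonneg (fun k hk => ?_) fun k _ _ => by positivity
    exact Finset.mem_range.2 (Finset.mem_filter.1 hk).2

theorem exists_apply_ne (hm : 2 ≤ m) (hH : MulAction.IsPretransitive H (Fin m)) :
    ∃ (z : Fin m) (σ : H), σ.1 z ≠ z := by
  obtain ⟨σ, hσ⟩ := hH.exists_smul_eq (⟨0, by omega⟩ : Fin m) ⟨1, by omega⟩
  refine ⟨⟨0, by omega⟩, σ, fun h => ?_⟩
  have := (show σ.1 ⟨0, by omega⟩ = ⟨1, by omega⟩ from hσ).symm.trans h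
  simp at this

end IteratedWreath

/-! ### The three spectra -/

open IteratedWreath

theorem mainTheorem2 (m : ℕ) (hm : 2 ≤ m) (H : Subgroup (Equiv.Perm (Fin m)))
    (hH : MulAction.IsPretransitive H (Fin m)) :
    ∃ b : ℕ, 2 ≤ b ∧
      (TreeAut.levelFiltration (iteratedWreathProduct H)).hspecBounded b = Set.Icc 0 1 ∧
      (TreeAut.levelFiltration (iteratedWreathProduct H)).hspecFG = Set.Icc 0 1 ∧
      (TreeAut.levelFiltration (iteratedWreathProduct H)).hspec = Set.Icc 0 1 := by
  classical
  let : Fintype H := Fintype.ofFinite H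
  obtain ⟨z, σ, hσ⟩ := exists_apply_ne hm hH
  have hq : 2 ≤ Nat.card H := by
    rw [Nat.card_eq_fintype_card]
    refine Fintype.one_lt_card_iff.2 ⟨σ, 1, fun h => hσ ?_⟩
    simp [h]
  have hle : ∀ K : Subgroup (iteratedWreathProduct H),
      (TreeAut.levelFiltration (iteratedWreathProduct H)).hdim K ∈ Set.Icc 0 1 := fun K =>
    ⟨zero_le, hdim_le_one (by omega) hq K⟩
  have hge : ∀ d ∈ Set.Icc (0 : ℝ≥0∞) 1, ∃ K : Subgroup (iteratedWreathProduct H),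
      (TreeAut.levelFiltration (iteratedWreathProduct H)).IsClosedSubgroup K ∧
      (∃ S : Finset (iteratedWreathProduct H), S.card ≤ Fintype.card (GeneratorIndex H) ∧
        (TreeAut.levelFiltration (iteratedWreathProduct H)).TopologicallyGenerates S K) ∧
      (TreeAut.levelFiltration (iteratedWreathProduct H)).hdim K = d := by
    intro d hd
    lift d to NNReal using ne_top_of_le_ne_top ENNReal.one_ne_top hd.2
    have hd1 : d ≤ 1 := by exact_mod_cast hd.2
    obtain ⟨U, hU, hcard⟩ := exists_region (show 0 < m by omega) d d.2 hd1
    refine ⟨_, GroupFiltration.isClosedSubgroup_closedSubgroup _ _,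
      ⟨Finset.univ.image (generator hσ (prefixFree_minimalWords U)), Finset.card_image_le, ?_⟩,
      hdim_closedSubgroup hm hH hq hσ hU d hd1 (fun n => (hcard n).1) fun n => (hcard n).2⟩
    rw [Finset.coe_image, Finset.coe_univ, Set.image_univ]
    rfl
  -- The bound is 6 * |H| + 1, independent of the dimension to be realized.
  refine ⟨Fintype.card (GeneratorIndex H), ?_, ?_, ?_, ?_⟩
  · have : 0 < Fintype.card H := Fintype.card_pos
    simp only [GeneratorIndex, Fintype.card_sum, Fintype.card_prod, Fintype.card_unit]
    omega
  · refine Set.Subset.antisymm ?_ hge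
    rintro _ ⟨K, -, -, rfl⟩
    exact hle K
  · refine Set.Subset.antisymm ?_ fun d hd => ?_
    · rintro _ ⟨K, -, -, rfl⟩
      exact hle K
    · obtain ⟨K, hK, ⟨S, -, hS⟩, rfl⟩ := hge d hd
      exact ⟨K, hK, ⟨S, hS⟩, rfl⟩
  · refine Set.Subset.antisymm ?_ fun d hd => ?_
    · rintro _ ⟨K, -, rfl⟩
      exact hle K
    · obtain ⟨K, hK, -, rfl⟩ := hge d hd
      exact ⟨K, hK, rfl⟩
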